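/- **Conventions.** Let $M$ be a monoid. Say that $a$ left (resp. right) divides $b$ if $ax=b$ (resp. $xa=b$) for some $x\in M$. Left/right gcds are greatest lower bounds for left/right divisibility; a right (resp. left) lcm is a least upper bound for left (resp. right) divisibility. $M$ is a *gcd-monoid* if it is cancellative, $1$ is its only invertible element, and any two elements have a left gcd and a right gcd; it is *noetherian* if the proper left and the proper right divisibility relations are well-founded. A *multifraction* on $M$ is a finite (possibly empty) sequence $\underline a=(a_1^{\pm},\dots,a_d^{\pm})$ of elements of $M$ with alternating signs (starting with either sign). It is *trivial* if all $a_i=1$, and *unital* if the product of the images of the $a_i^{\pm1}$ in the enveloping (universal) group of $M$ is $1$. For $i<d$ and $x\in M$, the rule $R_{i,x}$ turns $\underline a$ into a multifraction $\underline b$ with the same depth and signs, $b_k=a_k$ for $k\notin\{i-1,i,i+1\}$, and, for some $x'\in M$: * $i\ge2$ positive: $b_{i-1}=x'a_{i-1}$, $b_ix=x'a_i$ is a left lcm of $x$ and $a_i$, and $b_{i+1}x=a_{i+1}$; * $i\ge2$ negative: $b_{i-1}=a_{i-1}x'$, $xb_i=a_ix'$ is a right lcm of $x$ and $a_i$, and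 $xb_{i+1}=a_{i+1}$; * $i=1$ positive: $b_1x=a_1$, $b_2x=a_2$; * $i=1$ negative: $xb_1=a_1$, $xb_2=a_2$. Write $\underline a\Rightarrow\underline b$ if some $R_{i,x}$ with $x\ne1$ leads from $\underline a$ to $\underline b$, let $\Rightarrow^*$ be its reflexive-transitive closure, and call $\underline a$ irreducible if there is no $\underline b$ with $\underline a\Rightarrow\underline b$. Reduction is *convergent* for $M$ if for every multifraction $\underline a$ there is exactly one irreducible $\underline b$ with $\underline a\Rightarrow^*\underline b$; it is *semi-convergent* if a multifraction is unital if and only if it reduces ($\Rightarrow^*$) to a trivial multifraction. The *interval monoid* of a poset $P$ is the monoid generated by the intervals $[x,y]$ ($x\le y$ in $P$) with the relations $[x,z]=[x,y][y,z]$ for $x\le y\le z$, and $[x,x]=1$. A *zigzag* of length $m\ge1$ in $P$ is a sequence $(x_0,\dots,x_m)$ with $x_0<x_1>x_2<\cdots$ or $x_0>x_1<x_2>\cdots$; it is *closed* if $x_m=x_0$, and *simple* if $x_1,\dots,x_m$ are pairwise distinct. For $n\ge1$, let $P_{A,n}$ be the poset with elements $x_i$ ($1\le i\le 2\lfloor n/2\rfloor+1$),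 $y_j$ ($0\le j\le n+1$), $z_k$ ($1\le k\le 2\lfloor (n+1)/2\rfloor+1$), whose Hasse diagram has the upward edges $x_i\to y_{i-1}$ and $x_i\to y_{i+1}$ for all $i$, $x_i\to y_i$ for $i$ odd, $y_{k-2}\to z_k$ and $y_k\to z_k$ for all $k$, and $y_{k-1}\to z_k$ for $k$ odd (whenever both end points exist). Thus $P_{A,1}$ is the seven-element poset $P_A$ consisting of a least element $x_1$, three atoms $y_0,y_1,y_2$, and one upper bound for each pair of atoms, and $P_{A,n}$ is a chain of $n$ copies of, alternately, $P_A$ and its mirror image, consecutive copies being glued along a diamond. **Proposition.** For every $n\ge1$, the poset $P_{A,n}$ has $3n+4$ elements, and its interval monoid is a noetherian gcd-monoid for which reduction is semi-convergent but not convergent. Moreover, for every $n\ge2$, there is a simple closed zigzag of length $2n+2$ in $P_{A,n}$; so the posets $P_{A,n}$ have simple closed zigzags of arbitrarily large length. -/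

import Mathlib

namespace MFR

section Monoids

variable {M : Type*} [Monoid M]

/-- `a` left divides `b`: `b` is a right multiple of `a`. -/
def LeftDvd (a b : M) : Prop := ∃ x, a * x = b

/-- `a` right divides `b`: `b` is a left multiple of `a`. -/
def RightDvd (a b : M) : Prop := ∃ x, x * a = b

/-- `d` is a left gcd of `a` and `b`: a greatest lower bound for left divisibility. -/
def IsLeftGcd (a b d : M) : Prop :=
  LeftDvd d a ∧ LeftDvd d b ∧ ∀ e, LeftDvd e a → LeftDvd e b → LeftDvd e d

/-- `d` is a right gcd of `a` and `b`: a greatest lower bound for right divisibility. -/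
def IsRightGcd (a b d : M) : Prop :=
  RightDvd d a ∧ RightDvd d b ∧ ∀ e, RightDvd e a → RightDvd e b → RightDvd e d

/-- `m` is a right lcm of `a` and `b`: a least upper bound for left divisibility. -/
def IsRightLcm (a b m : M) : Prop :=
  LeftDvd a m ∧ LeftDvd b m ∧ ∀ e, LeftDvd a e → LeftDvd b e → LeftDvd m e

/-- `m` is a left lcm of `a` and `b`: a least upper bound for right divisibility. -/
def IsLeftLcm (a b m : M) : Prop :=
  RightDvd a m ∧ RightDvd b m ∧ ∀ e, RightDvd a e → RightDvd b e → RightDvd m e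

variable (M)

/-- A gcd-monoid: cancellative, `1` is the only invertible element, and any two elements admit
a left gcd and a right gcd. -/
structure IsGcdMonoid : Prop where
  mul_left_cancel : ∀ a b c : M, a * b = a * c → b = c
  mul_right_cancel : ∀ a b c : M, b * a = c * a → b = c
  eq_one_of_isUnit : ∀ a : M, IsUnit a → a = 1
  exists_leftGcd : ∀ a b : M, ∃ d, IsLeftGcd a b d
  exists_rightGcd : ∀ a b : M, ∃ d, IsRightGcd a b d

/-- Noetherianity (of a cancellative monoid with no nontrivial invertible element): the proper
left and right divisibility relations are well-founded. -/
structure IsNoetherianMonoid : Prop where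
  wf_left : WellFounded fun a b : M => LeftDvd a b ∧ a ≠ b
  wf_right : WellFounded fun a b : M => RightDvd a b ∧ a ≠ b

/-- The enveloping group of `M`: the group presented by the generators `M` and all relations
`a · b = ab`. -/
abbrev EnvelopingGroup : Type _ :=
  PresentedGroup {r : FreeGroup M |
    ∃ a b : M, r = FreeGroup.of a * FreeGroup.of b * (FreeGroup.of (a * b))⁻¹}

/-- The canonical morphism from `M` to its enveloping group. -/
def toEnvelopingGroup : M →* EnvelopingGroup M :=
  MonoidHom.mk' (M := M) (G := EnvelopingGroup M) (fun a => PresentedGroup.of a) (by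
    intro a b
    symm
    have h : (PresentedGroup.mk {r : FreeGroup M |
        ∃ a b : M, r = FreeGroup.of a * FreeGroup.of b * (FreeGroup.of (a * b))⁻¹})
        (FreeGroup.of a * FreeGroup.of b * (FreeGroup.of (a * b))⁻¹) = 1 :=
      PresentedGroup.one_of_mem ⟨a, b, rfl⟩
    rw [map_mul, map_mul, map_inv] at h
    exact mul_inv_eq_one.mp h)

/-- A multifraction on `M`: a finite, possibly empty, sequence of signed elements of `M` with
alternating signs, starting with either sign. An entry `(true, a)` is the positive entry `a`, an
entry `(false, a)` is the negative entry, that is, the copy of `a` in the disjoint copy of `M`. -/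
@[ext]
structure Multifraction where
  entries : List (Bool × M)
  alternating : entries.IsChain fun s t => s.1 ≠ t.1

variable {M}

/-- `RedRule x a b` says that `b` results from `a` by the rule `R_{i,x}` at some level `i`.
In `pos` and `neg` the level is `i = p.length + 2`, it is positive resp. negative in `a`, and
`a₁`, `a₂`, `a₃` are the entries at the levels `i - 1`, `i`, `i + 1`. In `pos_one` and `neg_one` the
level is `i = 1`, and `a₁`, `a₂` are the entries at the levels `1`, `2`. -/
inductive RedRule (x : M) : List (Bool × M) → List (Bool × M) → Prop
  | pos (p q : List (Bool × M)) (a₁ a₂ a₃ b₁ b₂ b₃ x' : M)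
      (h₁ : b₁ = x' * a₁) (h₂ : b₂ * x = x' * a₂) (hlcm : IsLeftLcm x a₂ (x' * a₂))
      (h₃ : b₃ * x = a₃) :
      RedRule x (p ++ (false, a₁) :: (true, a₂) :: (false, a₃) :: q)
        (p ++ (false, b₁) :: (true, b₂) :: (false, b₃) :: q)
  | neg (p q : List (Bool × M)) (a₁ a₂ a₃ b₁ b₂ b₃ x' : M)
      (h₁ : b₁ = a₁ * x') (h₂ : x * b₂ = a₂ * x') (hlcm : IsRightLcm x a₂ (a₂ * x'))
      (h₃ : x * b₃ = a₃) :
      RedRule x (p ++ (true, a₁) :: (false, a₂) :: (true, a₃) :: q)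
        (p ++ (true, b₁) :: (false, b₂) :: (true, b₃) :: q)
  | pos_one (q : List (Bool × M)) (a₁ a₂ b₁ b₂ : M) (h₁ : b₁ * x = a₁) (h₂ : b₂ * x = a₂) :
      RedRule x ((true, a₁) :: (false, a₂) :: q) ((true, b₁) :: (false, b₂) :: q)
  | neg_one (q : List (Bool × M)) (a₁ a₂ b₁ b₂ : M) (h₁ : x * b₁ = a₁) (h₂ : x * b₂ = a₂) :
      RedRule x ((false, a₁) :: (true, a₂) :: q) ((false, b₁) :: (true, b₂) :: q)

namespace Multifraction

/-- One step of reduction: some rule `R_{i,x}` with `x ≠ 1` leads from `a` to `b`. -/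
def Red (a b : Multifraction M) : Prop := ∃ x : M, x ≠ 1 ∧ RedRule x a.entries b.entries

/-- The reflexive-transitive closure of one-step reduction. -/
def Reds : Multifraction M → Multifraction M → Prop := Relation.ReflTransGen Red

/-- No rule `R_{i,x}` with `x ≠ 1` applies. -/
def Irreducible (a : Multifraction M) : Prop := ¬ ∃ b, Red a b

/-- All entries are equal to `1`. -/
def Trivial (a : Multifraction M) : Prop := ∀ s ∈ a.entries, s.2 = 1

/-- The element of the enveloping group represented by a multifraction: the product of the images
of its positive entries and of the inverses of the images of its negative entries, in order. -/
def eval (a : Multifraction M) : EnvelopingGroup M :=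
  (a.entries.map fun s =>
    if s.1 = true then toEnvelopingGroup M s.2 else (toEnvelopingGroup M s.2)⁻¹).prod

/-- The multifraction represents `1` in the enveloping group. -/
def Unital (a : Multifraction M) : Prop := a.eval = 1

end Multifraction

variable (M)

/-- Reduction is convergent: every multifraction reduces to exactly one irreducible one. -/
def Convergent : Prop :=
  ∀ a : Multifraction M, ∃! b : Multifraction M, a.Reds b ∧ b.Irreducible

/-- Reduction is semi-convergent: a multifraction is unital if and only if it reduces to a trivial
one. Since reduction preserves the depth and the signs, the latter is necessarily the sequence of
`1`s of the same depth and the same signs. -/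
def SemiConvergent : Prop :=
  ∀ a : Multifraction M, a.Unital ↔ ∃ b : Multifraction M, b.Trivial ∧ a.Reds b

end Monoids

section Posets

variable (P : Type*) [PartialOrder P]

/-- The defining relations of the interval monoid: `[x, z] = [x, y] · [y, z]` for `x ≤ y ≤ z`, and
`[x, x] = 1`. The interval `[x, y]` with `x ≤ y` is given by the pair of its end points. -/
inductive IntervalRel :
    FreeMonoid (NonemptyInterval P) → FreeMonoid (NonemptyInterval P) → Prop
  | comp (x y z : P) (hxy : x ≤ y) (hyz : y ≤ z) :
      IntervalRel (FreeMonoid.of ⟨(x, z), hxy.trans hyz⟩)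
        (FreeMonoid.of ⟨(x, y), hxy⟩ * FreeMonoid.of ⟨(y, z), hyz⟩)
  | refl (x : P) : IntervalRel (FreeMonoid.of ⟨(x, x), le_refl x⟩) 1

/-- The interval monoid of the poset `P`. -/
abbrev IntervalMonoid : Type _ := PresentedMonoid (IntervalRel P)

variable {P}

/-- `(x 0, …, x n)` is a positive zigzag: `x 0 < x 1 > x 2 < ⋯`. -/
def IsPosZigzag {n : ℕ} (x : Fin (n + 1) → P) : Prop :=
  ∀ i : Fin n, (Even (i : ℕ) → x i.castSucc < x i.succ) ∧ (Odd (i : ℕ) → x i.succ < x i.castSucc)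

/-- `(x 0, …, x n)` is a negative zigzag: `x 0 > x 1 < x 2 > ⋯`. -/
def IsNegZigzag {n : ℕ} (x : Fin (n + 1) → P) : Prop :=
  ∀ i : Fin n, (Odd (i : ℕ) → x i.castSucc < x i.succ) ∧ (Even (i : ℕ) → x i.succ < x i.castSucc)

/-- `(x 0, …, x n)` is a simple closed zigzag of length `n`: `n ≥ 1`, it is a positive or a negative
zigzag, `x n = x 0`, and `x 1, …, x n` are pairwise distinct. -/
def IsSimpleClosedZigzag {n : ℕ} (x : Fin (n + 1) → P) : Prop :=
  1 ≤ n ∧ (IsPosZigzag x ∨ IsNegZigzag x) ∧ x (Fin.last n) = x 0 ∧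
    Function.Injective fun i : Fin n => x i.succ

end Posets

/-- The vertices of the poset `P_{A,n}`, on three levels:
`x_i` for `1 ≤ i ≤ 2⌊n/2⌋ + 1` (bottom), `y_j` for `0 ≤ j ≤ n + 1` (middle), and
`z_k` for `1 ≤ k ≤ 2⌊(n+1)/2⌋ + 1` (top). -/
inductive PA (n : ℕ) : Type
  | x (i : Finset.Icc 1 (2 * (n / 2) + 1)) : PA n
  | y (j : Fin (n + 2)) : PA n
  | z (k : Finset.Icc 1 (2 * ((n + 1) / 2) + 1)) : PA n

namespace PA

/-- The edges of the Hasse diagram of `P_{A,n}`, oriented upwards. A bottom vertex `x_i` lies below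
`y_{i-1}`, `y_{i+1}` and, if `i` is odd, also below `y_i`; a top vertex `z_k` lies above `y_{k-2}`,
`y_k` and, if `k` is odd, also above `y_{k-1}` (whenever these vertices exist).

For odd `m ≤ n`, the seven vertices `x_m`, `y_{m-1}`, `y_m`, `y_{m+1}`, and the pairwise upper bounds
`z_m`, `z_{m+1}`, `z_{m+2}` of the latter three form a copy of the seven-vertex poset
`P_A = P_{A,1}`; for even `m ≤ n`, the seven vertices `z_{m+1}`, `y_{m-1}`, `y_m`, `y_{m+1}`, and the
pairwise lower bounds `x_{m-1}`, `x_m`, `x_{m+1}` of the latter three form a copy of its mirror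
image. Consecutive copies share the four vertices and four edges of a diamond, so that
`P_{A,n+1}` has three vertices and five edges more than `P_{A,n}`. -/
inductive Edge {n : ℕ} : PA n → PA n → Prop
  | xy (i : Finset.Icc 1 (2 * (n / 2) + 1)) (j : Fin (n + 2))
      (h : (j : ℕ) + 1 = i ∨ (j : ℕ) = i + 1 ∨ (Odd (i : ℕ) ∧ (j : ℕ) = i)) :
      Edge (x i) (y j)
  | yz (j : Fin (n + 2)) (k : Finset.Icc 1 (2 * ((n + 1) / 2) + 1))
      (h : (k : ℕ) = j ∨ (k : ℕ) = j + 2 ∨ (Odd (k : ℕ) ∧ (k : ℕ) = j + 1)) :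
      Edge (y j) (z k)

/-- The partial order with the above Hasse diagram: `a ≤ b` if and only if there is an upward path
from `a` to `b` along the edges. All upward paths have length at most two. -/
instance (n : ℕ) : PartialOrder (PA n) where
  le a b := a = b ∨ Edge a b ∨ ∃ c, Edge a c ∧ Edge c b
  le_refl a := Or.inl rfl
  le_trans a b c := by
    rintro (rfl | hab | ⟨d, had, hdb⟩) hbc
    · exact hbc
    · rcases hbc with rfl | hbc | ⟨e, hbe, hec⟩
      · exact Or.inr (Or.inl hab)
      · exact Or.inr (Or.inr ⟨b, hab, hbc⟩)
      · cases hab <;> cases hbe <;> cases hec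
    · rcases hbc with rfl | hbc | ⟨e, hbe, hec⟩
      · exact Or.inr (Or.inr ⟨d, had, hdb⟩)
      · cases had <;> cases hdb <;> cases hbc
      · cases had <;> cases hdb <;> cases hbe
  le_antisymm a b := by
    rintro (rfl | hab | ⟨d, had, hdb⟩) hba
    · rfl
    · rcases hba with rfl | hba | ⟨e, hbe, hea⟩
      · rfl
      · cases hab <;> cases hba
      · cases hab <;> cases hbe <;> cases hea
    · rcases hba with rfl | hba | ⟨e, hbe, hea⟩
      · rfl
      · cases had <;> cases hdb <;> cases hba
      · cases had <;> cases hdb <;> cases hbe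

end PA

end MFR

/-! The interval monoid of a poset `P` embeds in the free group on `P` by `[p, q] ↦ p⁻¹ q`. Every
element is a product of proper intervals no two consecutive ones of which are composable, and such a
product goes to a freely reduced word (`toFree_injective`). Hence these normal forms are unique, and
cancellativity, divisibility, gcds and lcms can be read off from them. Gcds exist because two
elements of `P` with a common lower (upper) bound have a meet (join). A grading of `P` gives an
additive length, hence noetherianity and termination of reduction.

By termination, semi-convergence only requires that a nontrivial unital multifraction be reducible.
Write its entries as a path of intervals, read upwards in positive entries and downwards in negative
ones. The product is trivial in the free group, so some consecutive steps form a closed path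
(`exists_closed_block`). Suppose that no reduction applies. Composable steps never lie in the same
entry, and no trivial entry separates two steps of the path. So the path is a closed zigzag whose
steps, except possibly the first and the last, are whole entries. A turn `p, q, r` after the first
one would give a reduction by an interval with end points `s` and `q` as soon as `TurnRed` holds;
the first turn gives one if its two steps overlap. It remains to show that a closed zigzag always
has such a turn (`closedZigzagsReducible_of_strip`).

The poset `P_{A,n}` is drawn as a horizontal strip with three levels in which comparable vertices
have positions at distance at most two. A turn whose first vertex is on the middle level is
reducible. So, except near its ends, an irreducible zigzag alternates between bottom and top, and
each such turn keeps its direction and advances by at least three positions. It cannot come back to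
its start, which is within distance two of its second vertex.

Convergence already fails in the leftmost copy of `P_A`: with bottom `b`, atoms `y₀, y₁, y₂` and
`z₃` above `y₁, y₂`, the multifraction `1 / [b, y₀] / [b, z₃]` can be reduced by `[b, y₁]` or by
`[b, y₂]`, with different irreducible results. The long simple closed zigzag runs once around the
strip. -/

namespace MFR

/-! ### Words of alternating sign in a free group. -/

section FreeGroupWords

variable {P : Type*}

/-- The signed word `p₁⁻¹ q₁ p₂⁻¹ q₂ ⋯` of a list of pairs `(pᵢ, qᵢ)`. -/
def pairWord (l : List (P × P)) : List (P × Bool) :=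
  l.flatMap fun e => [(e.1, false), (e.2, true)]

/-- The product `p₁⁻¹ q₁ p₂⁻¹ q₂ ⋯` in the free group on `P`. -/
def pairProd (l : List (P × P)) : FreeGroup P :=
  (l.map fun e => (FreeGroup.of e.1)⁻¹ * FreeGroup.of e.2).prod

@[simp] theorem pairProd_nil : pairProd ([] : List (P × P)) = 1 := rfl

@[simp] theorem pairProd_cons (e : P × P) (l : List (P × P)) :
    pairProd (e :: l) = (FreeGroup.of e.1)⁻¹ * FreeGroup.of e.2 * pairProd l := by
  simp [pairProd]

theorem pairProd_append (l l' : List (P × P)) :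
    pairProd (l ++ l') = pairProd l * pairProd l' := by
  simp [pairProd]

theorem pairProd_reverse_swap (l : List (P × P)) :
    pairProd (l.map Prod.swap).reverse = (pairProd l)⁻¹ := by
  induction l with
  | nil => simp
  | cons e l ih => simp [pairProd_append, ih]

theorem pairProd_eq_mk (l : List (P × P)) : pairProd l = FreeGroup.mk (pairWord l) := by
  induction l with
  | nil => rfl
  | cons e l ih =>
    rw [pairProd_cons, ih]
    simp [pairWord, FreeGroup.of, FreeGroup.invRev]

/-- The two hypotheses say exactly that neither `p⁻¹ q` inside a pair nor `q p⁻¹` between two pairs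
cancels. -/
theorem isReduced_pairWord {l : List (P × P)} (h : ∀ e ∈ l, e.1 ≠ e.2)
    (hc : l.IsChain fun e f => e.2 ≠ f.1) : FreeGroup.IsReduced (pairWord l) := by
  induction l with
  | nil => simp [pairWord]
  | cons e l ih =>
    have h1 := ih (fun f hf => h f (List.mem_cons_of_mem _ hf)) hc.of_cons
    have h2 := h e List.mem_cons_self
    cases l with
    | nil => simpa [pairWord, FreeGroup.IsReduced] using h2
    | cons f l =>
      have h3 := (List.isChain_cons_cons.1 hc).1
      simp only [pairWord, List.flatMap_cons, List.cons_append, List.nil_append,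
        FreeGroup.isReduced_cons_cons] at h1 ⊢
      exact ⟨fun h' => absurd h' h2, fun h' => absurd h' h3, h1⟩

theorem pairWord_injective : Function.Injective (pairWord : List (P × P) → _) := by
  intro l
  induction l with
  | nil => intro l' h; cases l' <;> simp_all [pairWord]
  | cons e l ih =>
    intro l' h
    cases l' with
    | nil => simp [pairWord] at h
    | cons f l' =>
      simp only [pairWord, List.flatMap_cons, List.cons_append, List.nil_append,
        List.cons.injEq, Prod.mk.injEq, and_true] at h
      rw [Prod.ext h.1 h.2.1, ih h.2.2]

theorem pairProd_inj {l l' : List (P × P)} (h : ∀ e ∈ l, e.1 ≠ e.2)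
    (hc : l.IsChain fun e f => e.2 ≠ f.1) (h' : ∀ e ∈ l', e.1 ≠ e.2)
    (hc' : l'.IsChain fun e f => e.2 ≠ f.1) (heq : pairProd l = pairProd l') : l = l' := by
  classical
  apply pairWord_injective
  rw [← (isReduced_pairWord h hc).reduce_eq, ← (isReduced_pairWord h' hc').reduce_eq,
    ← FreeGroup.toWord_mk, ← FreeGroup.toWord_mk, ← pairProd_eq_mk, ← pairProd_eq_mk, heq]

theorem pairProd_of_composable {l : List (P × P)} (hc : l.IsChain fun e f => e.2 = f.1)
    (hn : l ≠ []) :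
    pairProd l = (FreeGroup.of (l.head hn).1)⁻¹ * FreeGroup.of (l.getLast hn).2 := by
  induction l with
  | nil => exact absurd rfl hn
  | cons e l ih =>
    cases l with
    | nil => simp
    | cons f l =>
      rw [pairProd_cons, ih hc.of_cons (by simp)]
      have := (List.isChain_cons_cons.1 hc).1
      simp [this, mul_assoc]

/-- A nonempty list of pairs with trivial product contains a composable closed block. -/
theorem exists_closed_block {l : List (P × P)} (hn : l ≠ []) (h1 : pairProd l = 1) :
    ∃ A B C : List (P × P), ∃ hB : B ≠ [], l = A ++ B ++ C ∧
      (B.IsChain fun e f => e.2 = f.1) ∧ (B.head hB).1 = (B.getLast hB).2 := by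
  classical
  by_contra hcon
  -- Cut `l` into maximal composable blocks. If none were closed, replacing each block by its pair
  -- of end points would leave the product unchanged and give a reduced word, which must then be
  -- empty.
  set r : P × P → P × P → Bool := fun e f => decide (e.2 = f.1) with hr
  set S := l.splitBy r with hS
  have hne : ∀ B ∈ S, B ≠ [] := fun B hB => List.ne_nil_of_mem_splitBy hB
  have hfl : S.flatten = l := List.flatten_splitBy r l
  have hch : ∀ B ∈ S, B.IsChain fun e f => e.2 = f.1 := fun B hB => by
    simpa [hr] using List.isChain_of_mem_splitBy hB
  have hop : ∀ B (hB : B ∈ S), (B.head (hne B hB)).1 ≠ (B.getLast (hne B hB)).2 := by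
    intro B hB heq
    obtain ⟨s, t, hst⟩ := List.append_of_mem hB
    refine hcon ⟨s.flatten, B, t.flatten, hne B hB, ?_, hch B hB, heq⟩
    rw [← hfl, hst]; simp
  -- The value at the empty block is a dummy: all blocks are nonempty.
  let ends : List (P × P) → P × P := fun B =>
    if hB : B = [] then (l.head hn) else ((B.head hB).1, (B.getLast hB).2)
  have hends : ∀ B (hB : B ∈ S), ends B = ((B.head (hne B hB)).1, (B.getLast (hne B hB)).2) :=
    fun B hB => by simp [ends, hne B hB]
  have hprod : pairProd (S.map ends) = pairProd l := by
    rw [← hfl]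
    clear_value S
    have : ∀ T : List (List (P × P)), (∀ B ∈ T, B ∈ S) →
        pairProd (T.map ends) = pairProd T.flatten := by
      intro T
      induction T with
      | nil => simp
      | cons B T ih =>
        intro hT
        have hB := hT B List.mem_cons_self
        rw [List.map_cons, pairProd_cons, List.flatten_cons, pairProd_append,
          ih fun C hC => hT C (List.mem_cons_of_mem _ hC),
          pairProd_of_composable (hch B hB) (hne B hB), hends B hB]
    exact this S fun _ h => h
  have hnil : S.map ends = [] := by
    refine pairProd_inj ?_ ?_ (by simp) (by simp) (hprod.trans h1)
    · intro e he
      obtain ⟨B, hB, rfl⟩ := List.mem_map.1 he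
      rw [hends B hB]
      exact hop B hB
    · rw [List.isChain_map]
      have hsep := List.isChain_getLast_head_splitBy r l
      refine List.IsChain.imp_of_mem_imp ?_ hsep
      rintro a b ha hb ⟨ha', hb', hab⟩
      rw [hends a ha, hends b hb]
      simpa [hr] using hab
  have : S = [] := by simpa using hnil
  exact hn (by rw [← hfl, this]; rfl)

end FreeGroupWords

/-! ### Normal forms and left gcds in interval monoids. -/

section IntervalMonoids

variable {P : Type*} [PartialOrder P]

open Classical in
/-- The interval `[p, q]` as an element of the interval monoid (`1` if `p ≤ q` fails). -/
noncomputable def iv (p q : P) : IntervalMonoid P :=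
  if h : p ≤ q then PresentedMonoid.of (IntervalRel P) ⟨(p, q), h⟩ else 1

theorem iv_self (p : P) : iv p p = 1 := by
  rw [iv, dif_pos le_rfl]
  exact PresentedMonoid.mk_eq_mk_of_rel (.refl p)

theorem iv_mul {p q r : P} (h : p ≤ q) (h' : q ≤ r) : iv p q * iv q r = iv p r := by
  rw [iv, iv, iv, dif_pos h, dif_pos h', dif_pos (h.trans h')]
  exact (PresentedMonoid.mk_eq_mk_of_rel (.comp p q r h h')).symm

theorem iv_mul_assoc {p q r : P} (h : p ≤ q) (h' : q ≤ r) (a : IntervalMonoid P) :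
    iv p q * (iv q r * a) = iv p r * a := by
  rw [← mul_assoc, iv_mul h h']

/-- A morphism of monoids on the interval monoid is given by a functor. -/
def ivLift {N : Type*} [Monoid N] (f : P → P → N) (h1 : ∀ p, f p p = 1)
    (hmul : ∀ p q r, p ≤ q → q ≤ r → f p q * f q r = f p r) : IntervalMonoid P →* N :=
  PresentedMonoid.lift (fun I : NonemptyInterval P => f I.fst I.snd) (by
    intro a b hab
    cases hab with
    | comp x y z hxy hyz => simp [hmul x y z hxy hyz]
    | refl x => simp [h1])

theorem ivLift_iv {N : Type*} [Monoid N] (f : P → P → N) (h1 : ∀ p, f p p = 1)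
    (hmul : ∀ p q r, p ≤ q → q ≤ r → f p q * f q r = f p r) {p q : P} (h : p ≤ q) :
    ivLift f h1 hmul (iv p q) = f p q := by
  rw [iv, dif_pos h]
  exact PresentedMonoid.lift_of _ _

theorem iv_induction {motive : IntervalMonoid P → Prop} (a : IntervalMonoid P) (one : motive 1)
    (mul : ∀ p q a, p ≤ q → motive a → motive (iv p q * a)) : motive a := by
  induction a using PresentedMonoid.inductionOn with
  | h w =>
    induction w using FreeMonoid.recOn with
    | one => simpa using one
    | of_mul I w ih =>
      rw [map_mul]
      have := mul I.fst I.snd _ I.fst_le_snd ih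
      rwa [iv, dif_pos I.fst_le_snd] at this

/-- The product of a list of intervals. -/
noncomputable def nfProd (l : List (P × P)) : IntervalMonoid P := (l.map fun e => iv e.1 e.2).prod

@[simp] theorem nfProd_nil : nfProd ([] : List (P × P)) = 1 := rfl

@[simp] theorem nfProd_cons (e : P × P) (l : List (P × P)) :
    nfProd (e :: l) = iv e.1 e.2 * nfProd l := by
  simp [nfProd]

theorem nfProd_append (l l' : List (P × P)) : nfProd (l ++ l') = nfProd l * nfProd l' := by
  simp [nfProd]

/-- Normal forms: lists of proper intervals, no two consecutive ones of which are composable. -/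
def IsNF (l : List (P × P)) : Prop := (∀ e ∈ l, e.1 < e.2) ∧ l.IsChain fun e f => e.2 ≠ f.1

theorem IsNF.nil : IsNF ([] : List (P × P)) := ⟨by simp, by simp⟩

theorem isNF_singleton {p q : P} (h : p < q) : IsNF [(p, q)] := ⟨by simpa, by simp⟩

theorem isNF_cons_cons {e f : P × P} {l : List (P × P)} :
    IsNF (e :: f :: l) ↔ e.1 < e.2 ∧ e.2 ≠ f.1 ∧ IsNF (f :: l) := by
  simp only [IsNF, List.mem_cons, List.isChain_cons_cons, forall_eq_or_imp]
  tauto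

theorem IsNF.lt {p q : P} {l : List (P × P)} (h : IsNF ((p, q) :: l)) : p < q :=
  h.1 (p, q) List.mem_cons_self

theorem IsNF.tail {e : P × P} {l : List (P × P)} (h : IsNF (e :: l)) : IsNF l :=
  ⟨fun f hf => h.1 f (List.mem_cons_of_mem _ hf), h.2.of_cons⟩

theorem IsNF.replace {p q p' : P} {l : List (P × P)} (h : IsNF ((p, q) :: l)) (h' : p' < q) :
    IsNF ((p', q) :: l) := by
  cases l with
  | nil => exact isNF_singleton h'
  | cons f l =>
    rw [isNF_cons_cons] at h ⊢
    exact ⟨h', h.2⟩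

open Classical in
/-- The normal form of the product of a proper interval and a normal form. -/
noncomputable def nfCons (p q : P) : List (P × P) → List (P × P)
  | [] => [(p, q)]
  | (p', q') :: l => if q = p' then (p, q') :: l else (p, q) :: (p', q') :: l

theorem isNF_nfCons {p q : P} (h : p < q) {l : List (P × P)} (hl : IsNF l) :
    IsNF (nfCons p q l) := by
  match l with
  | [] => exact isNF_singleton h
  | (p', q') :: l =>
    rw [nfCons]
    split_ifs with h'
    · exact hl.replace (h.trans (h' ▸ hl.lt))
    · exact isNF_cons_cons.2 ⟨h, h', hl⟩

theorem nfProd_nfCons {p q : P} (h : p < q) {l : List (P × P)} (hl : IsNF l) :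
    nfProd (nfCons p q l) = iv p q * nfProd l := by
  match l with
  | [] => rfl
  | (p', q') :: l =>
    rw [nfCons]
    split_ifs with h'
    · subst h'
      rw [nfProd_cons, nfProd_cons, iv_mul_assoc h.le hl.lt.le]
    · rfl

theorem exists_nf (a : IntervalMonoid P) : ∃ l, IsNF l ∧ nfProd l = a := by
  induction a using iv_induction with
  | one => exact ⟨[], IsNF.nil, rfl⟩
  | mul p q a h ih =>
    obtain ⟨l, hl, rfl⟩ := ih
    rcases h.eq_or_lt with rfl | h
    · exact ⟨l, hl, by rw [iv_self, one_mul]⟩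
    · exact ⟨_, isNF_nfCons h hl, nfProd_nfCons h hl⟩

variable (P) in
/-- The morphism to the free group on `P` sending `[p, q]` to `p⁻¹ q`. -/
def toFree : IntervalMonoid P →* FreeGroup P :=
  ivLift (fun p q => (FreeGroup.of p)⁻¹ * FreeGroup.of q) (by simp)
    (by intros; simp [mul_assoc])

theorem toFree_iv {p q : P} (h : p ≤ q) :
    toFree P (iv p q) = (FreeGroup.of p)⁻¹ * FreeGroup.of q :=
  ivLift_iv _ _ _ h

theorem toFree_nfProd {l : List (P × P)} (h : IsNF l) : toFree P (nfProd l) = pairProd l := by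
  induction l with
  | nil => simp
  | cons e l ih => rw [nfProd_cons, map_mul, ih h.tail, toFree_iv h.lt.le, pairProd_cons]

theorem IsNF.ne {l : List (P × P)} (h : IsNF l) : ∀ e ∈ l, e.1 ≠ e.2 := fun e he => (h.1 e he).ne

/-- The reduced word of the image determines the normal form. Cancellativity is then inherited from
the free group. -/
theorem toFree_injective : Function.Injective (toFree P) := by
  intro a b hab
  obtain ⟨l, hl, rfl⟩ := exists_nf a
  obtain ⟨m, hm, rfl⟩ := exists_nf b
  rw [toFree_nfProd hl, toFree_nfProd hm] at hab
  rw [pairProd_inj hl.ne hl.2 hm.ne hm.2 hab]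

theorem IsNF.inj {l m : List (P × P)} (hl : IsNF l) (hm : IsNF m) (h : nfProd l = nfProd m) :
    l = m :=
  pairProd_inj hl.ne hl.2 hm.ne hm.2 (by rw [← toFree_nfProd hl, ← toFree_nfProd hm, h])

theorem intervalMonoid_mul_left_cancel (a b c : IntervalMonoid P) (h : a * b = a * c) : b = c := by
  apply toFree_injective
  simpa using congrArg (toFree P) h

theorem intervalMonoid_mul_right_cancel (a b c : IntervalMonoid P) (h : b * a = c * a) :
    b = c := by
  apply toFree_injective
  simpa using congrArg (toFree P) h

/-- A right multiple of an element whose normal form starts at `p` has a normal form starting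
at `p`. -/
theorem exists_nf_mul {p q : P} {l : List (P × P)} (hl : IsNF ((p, q) :: l))
    (c : IntervalMonoid P) :
    ∃ q' m, IsNF ((p, q') :: m) ∧ nfProd ((p, q') :: m) = nfProd ((p, q) :: l) * c ∧ q ≤ q' ∧
      (l ≠ [] → q' = q ∧ nfProd m = nfProd l * c) := by
  obtain ⟨k, hk, hkp⟩ := exists_nf (nfProd l * c)
  have hp := nfProd_nfCons hl.lt hk
  have hn := isNF_nfCons hl.lt hk
  rw [hkp, ← mul_assoc, ← nfProd_cons (p, q)] at hp
  match k with
  | [] =>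
    refine ⟨q, [], hn, hp, le_rfl, fun _ => ⟨rfl, hkp⟩⟩
  | (p', q') :: k =>
    rw [nfCons] at hp hn
    split_ifs at hp hn with h'
    · refine ⟨q', k, hn, hp, h' ▸ hk.lt.le, fun hne => ?_⟩
      -- A fusion at `q` would mean that the normal form of `nfProd l * c` starts at `q`. By
      -- recursion it starts where `l` starts, which differs from `q` since `(p, q) :: l` is normal.
      exfalso
      match l, hne with
      | (p₂, q₂) :: l, _ =>
        obtain ⟨q₃, m, hm, hmp, -⟩ := exists_nf_mul hl.tail c
        have := hm.inj hk (hmp.trans hkp.symm)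
        simp only [List.cons.injEq, Prod.mk.injEq] at this
        exact (isNF_cons_cons.1 hl).2.1 (h'.trans this.1.1.symm)
    · exact ⟨q, _, hn, hp, le_rfl, fun _ => ⟨rfl, hkp⟩⟩

/-- Right multiplication can only prolong the last interval of a normal form and append further
ones. So a left divisor is a prefix whose last interval may be cut short. -/
theorem leftDvd_cons_iff {p q : P} {m l : List (P × P)} (hm : IsNF ((p, q) :: m)) (hl : IsNF l) :
    LeftDvd (nfProd ((p, q) :: m)) (nfProd l) ↔ ∃ q' l', l = (p, q') :: l' ∧
      (m = [] ∧ q ≤ q' ∨ m ≠ [] ∧ q' = q ∧ LeftDvd (nfProd m) (nfProd l')) := by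
  constructor
  · rintro ⟨c, hc⟩
    obtain ⟨q', k, hk, hkp, hq, hne⟩ := exists_nf_mul hm c
    refine ⟨q', k, hl.inj hk (hc.symm.trans hkp.symm), ?_⟩
    by_cases hm0 : m = []
    · exact .inl ⟨hm0, hq⟩
    · exact .inr ⟨hm0, (hne hm0).1, c, (hne hm0).2.symm⟩
  · rintro ⟨q', l', rfl, ⟨rfl, h⟩ | ⟨-, rfl, c, hc⟩⟩
    · refine ⟨iv q q' * nfProd l', ?_⟩
      rw [nfProd_cons, nfProd_cons, nfProd_nil, mul_one, iv_mul_assoc hm.lt.le h]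
    · exact ⟨c, by rw [nfProd_cons, nfProd_cons, mul_assoc, hc]⟩

theorem leftDvd_iv_iff {p q : P} (h : p < q) {l : List (P × P)} (hl : IsNF l) :
    LeftDvd (iv p q) (nfProd l) ↔ ∃ q' l', l = (p, q') :: l' ∧ q ≤ q' := by
  have := leftDvd_cons_iff (isNF_singleton h) hl
  simpa using this

theorem eq_one_of_mul_eq_one {a b : IntervalMonoid P} (h : a * b = 1) : a = 1 := by
  obtain ⟨l, hl, rfl⟩ := exists_nf a
  match l with
  | [] => rfl
  | (p, q) :: l =>
    obtain ⟨q', m, hm, hmp, -⟩ := exists_nf_mul hl b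
    have := hm.inj IsNF.nil (hmp.trans h)
    simp at this

theorem LeftDvd.refl {M : Type*} [Monoid M] (a : M) : LeftDvd a a := ⟨1, mul_one a⟩

theorem LeftDvd.one {M : Type*} [Monoid M] (a : M) : LeftDvd 1 a := ⟨a, one_mul a⟩

theorem iv_ne_one {p q : P} (h : p < q) : iv p q ≠ 1 := by
  intro h1
  have := (isNF_singleton h).inj IsNF.nil (by simpa using h1)
  simp at this

/-- Any two elements with a common lower bound have a greatest lower bound. -/
def CondInf (P : Type*) [PartialOrder P] : Prop :=
  ∀ a b c : P, c ≤ a → c ≤ b → ∃ d, IsGLB {a, b} d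

/-- Any two elements with a common upper bound have a least upper bound. -/
def CondSup (P : Type*) [PartialOrder P] : Prop :=
  ∀ a b c : P, a ≤ c → b ≤ c → ∃ d, IsLUB {a, b} d

/-- Compare the first intervals: with different sources the gcd is `1`; if they agree, split them
off and recurse; with the same source and different targets, the gcd is the single interval up to
the meet of the targets. -/
theorem exists_leftGcd_nfProd (hP : CondInf P) {l m : List (P × P)} (hl : IsNF l) (hm : IsNF m) :
    ∃ d, IsLeftGcd (nfProd l) (nfProd m) d := by
  have triv : (∀ e, LeftDvd e (nfProd l) → LeftDvd e (nfProd m) → e = 1) →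
      ∃ d, IsLeftGcd (nfProd l) (nfProd m) d := fun h =>
    ⟨1, .one _, .one _, fun e h1 h2 => h e h1 h2 ▸ .refl _⟩
  match l, m with
  | [], m => exact triv fun e ⟨x, hx⟩ _ => eq_one_of_mul_eq_one hx
  | l, [] => exact triv fun e _ ⟨x, hx⟩ => eq_one_of_mul_eq_one hx
  | (p, q) :: l, (p', q') :: m =>
    by_cases hp : p = p'
    swap
    · refine triv fun e h1 h2 => ?_
      obtain ⟨k, hk, rfl⟩ := exists_nf e
      match k with
      | [] => rfl
      | (a, t) :: k =>
        obtain ⟨_, _, h3, -⟩ := (leftDvd_cons_iff hk hl).1 h1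
        obtain ⟨_, _, h4, -⟩ := (leftDvd_cons_iff hk hm).1 h2
        simp only [List.cons.injEq, Prod.mk.injEq] at h3 h4
        exact absurd (h3.1.1.trans h4.1.1.symm) hp
    subst hp
    by_cases hq : q = q'
    · subst hq
      obtain ⟨d, ⟨x, hx⟩, ⟨y, hy⟩, hd⟩ := exists_leftGcd_nfProd hP hl.tail hm.tail
      refine ⟨iv p q * d, ⟨x, by rw [mul_assoc, hx, nfProd_cons]⟩,
        ⟨y, by rw [mul_assoc, hy, nfProd_cons]⟩, fun e h1 h2 => ?_⟩
      obtain ⟨k, hk, rfl⟩ := exists_nf e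
      match k with
      | [] => exact .one _
      | (a, t) :: k =>
        obtain ⟨_, _, h3, h5⟩ := (leftDvd_cons_iff hk hl).1 h1
        obtain ⟨_, _, h4, h6⟩ := (leftDvd_cons_iff hk hm).1 h2
        simp only [List.cons.injEq, Prod.mk.injEq] at h3 h4
        obtain ⟨⟨rfl, rfl⟩, rfl⟩ := h3
        obtain ⟨⟨-, rfl⟩, rfl⟩ := h4
        rcases h5 with ⟨rfl, h5⟩ | ⟨hk0, rfl, h5⟩
        · refine ⟨iv t q * d, ?_⟩
          rw [nfProd_cons, nfProd_nil, mul_one, iv_mul_assoc hk.lt.le h5]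
        · rcases h6 with ⟨rfl, -⟩ | ⟨-, -, h6⟩
          · exact absurd rfl hk0
          · obtain ⟨z, hz⟩ := hd _ h5 h6
            exact ⟨z, by rw [nfProd_cons, mul_assoc, hz]⟩
    · obtain ⟨r, hr⟩ := hP q q' p hl.lt.le hm.lt.le
      have hpr : p ≤ r := hr.2 (by simp [hl.lt.le, hm.lt.le])
      have hrq : r ≤ q := hr.1 (by simp)
      have hrq' : r ≤ q' := hr.1 (by simp)
      refine ⟨iv p r, ⟨iv r q * nfProd l, by rw [iv_mul_assoc hpr hrq, nfProd_cons]⟩,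
        ⟨iv r q' * nfProd m, by rw [iv_mul_assoc hpr hrq', nfProd_cons]⟩, fun e h1 h2 => ?_⟩
      obtain ⟨k, hk, rfl⟩ := exists_nf e
      match k with
      | [] => exact .one _
      | (a, t) :: k =>
        obtain ⟨_, _, h3, h5⟩ := (leftDvd_cons_iff hk hl).1 h1
        obtain ⟨_, _, h4, h6⟩ := (leftDvd_cons_iff hk hm).1 h2
        simp only [List.cons.injEq, Prod.mk.injEq] at h3 h4
        obtain ⟨⟨rfl, rfl⟩, rfl⟩ := h3
        obtain ⟨⟨-, rfl⟩, rfl⟩ := h4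
        rcases h5 with ⟨rfl, h5⟩ | ⟨hk0, rfl, h5⟩
        · rcases h6 with ⟨-, h6⟩ | ⟨hk0, -, -⟩
          · refine ⟨iv t r, ?_⟩
            rw [nfProd_cons, nfProd_nil, mul_one,
              iv_mul hk.lt.le (hr.2 (by simp [h5, h6]))]
          · exact absurd rfl hk0
        · rcases h6 with ⟨rfl, -⟩ | ⟨-, rfl, -⟩
          · exact absurd rfl hk0
          · exact absurd rfl hq
termination_by l.length

theorem exists_leftGcd (hP : CondInf P) (a b : IntervalMonoid P) : ∃ d, IsLeftGcd a b d := by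
  obtain ⟨l, hl, rfl⟩ := exists_nf a
  obtain ⟨m, hm, rfl⟩ := exists_nf b
  exact exists_leftGcd_nfProd hP hl hm

/-- Common right multiples of two intervals with the same source. -/
theorem LeftDvd.iv_lub {p q r u : P} (hq : p < q) (hr : p < r) {e : IntervalMonoid P}
    (h1 : LeftDvd (iv p q) e) (h2 : LeftDvd (iv p r) e) :
    ∃ v, q ≤ v ∧ r ≤ v ∧ (u ≤ v → p ≤ u → LeftDvd (iv p u) e) := by
  obtain ⟨l, hl, rfl⟩ := exists_nf e
  obtain ⟨v, l', rfl, hv⟩ := (leftDvd_iv_iff hq hl).1 h1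
  obtain ⟨v', l'', h3, hv'⟩ := (leftDvd_iv_iff hr hl).1 h2
  simp only [List.cons.injEq, Prod.mk.injEq] at h3
  obtain ⟨⟨-, rfl⟩, rfl⟩ := h3
  refine ⟨v, hv, hv', fun huv hpu => ⟨iv u v * nfProd l', ?_⟩⟩
  rw [iv_mul_assoc hpu huv, nfProd_cons]

theorem isRightLcm_iv {p q r u : P} (hq : p < q) (hr : p < r) (hu : IsLUB {q, r} u) :
    IsRightLcm (iv p q) (iv p r) (iv p u) := by
  have hqu : q ≤ u := hu.1 (by simp)
  have hru : r ≤ u := hu.1 (by simp)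
  refine ⟨⟨iv q u, iv_mul hq.le hqu⟩, ⟨iv r u, iv_mul hr.le hru⟩, fun e h1 h2 => ?_⟩
  obtain ⟨v, hqv, hrv, h⟩ := h1.iv_lub (u := u) hq hr h2
  exact h (hu.2 (by simp [hqv, hrv])) (hq.le.trans hqu)

end IntervalMonoids

/-! ### Right divisibility by passing to the opposite poset. -/

section Duality

variable {P : Type*} [PartialOrder P]

/-- The anti-isomorphism from the interval monoid of `P` to that of the opposite poset. -/
noncomputable def flip : IntervalMonoid P →* (IntervalMonoid Pᵒᵈ)ᵐᵒᵖ :=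
  ivLift (fun p q => MulOpposite.op (iv (OrderDual.toDual q) (OrderDual.toDual p)))
    (fun p => by rw [iv_self, MulOpposite.op_one])
    (fun p q r h h' => by rw [← MulOpposite.op_mul, iv_mul (p := OrderDual.toDual r) (q := OrderDual.toDual q)
      (r := OrderDual.toDual p) h' h])

/-- The inverse of `flip`. -/
noncomputable def unflip : IntervalMonoid Pᵒᵈ →* (IntervalMonoid P)ᵐᵒᵖ :=
  ivLift (fun p q => MulOpposite.op (iv (OrderDual.ofDual q) (OrderDual.ofDual p)))
    (fun p => by rw [iv_self, MulOpposite.op_one])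
    (fun p q r h h' => by rw [← MulOpposite.op_mul, iv_mul (p := OrderDual.ofDual r) (q := OrderDual.ofDual q)
      (r := OrderDual.ofDual p) h' h])

theorem flip_iv {p q : P} (h : p ≤ q) :
    (flip (iv p q)).unop = iv (OrderDual.toDual q) (OrderDual.toDual p) := by
  rw [flip, ivLift_iv _ _ _ h, MulOpposite.unop_op]

theorem unflip_iv {p q : Pᵒᵈ} (h : p ≤ q) :
    (unflip (iv p q)).unop = iv (OrderDual.ofDual q) (OrderDual.ofDual p) := by
  rw [unflip, ivLift_iv _ _ _ h, MulOpposite.unop_op]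

theorem unflip_flip (a : IntervalMonoid P) : (unflip (flip a).unop).unop = a := by
  induction a using iv_induction with
  | one => simp
  | mul p q a h ih =>
    rw [map_mul, MulOpposite.unop_mul, map_mul, MulOpposite.unop_mul, ih, flip_iv h,
      unflip_iv (OrderDual.toDual_le_toDual.2 h)]
    rfl

theorem flip_unflip (a : IntervalMonoid Pᵒᵈ) : (flip (unflip a).unop).unop = a := by
  induction a using iv_induction with
  | one => simp
  | mul p q a h ih =>
    rw [map_mul, MulOpposite.unop_mul, map_mul, MulOpposite.unop_mul, ih, unflip_iv h,
      flip_iv (OrderDual.ofDual_le_ofDual.2 h)]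
    rfl

theorem leftDvd_flip_iff {a b : IntervalMonoid P} :
    LeftDvd (flip a).unop (flip b).unop ↔ RightDvd a b := by
  constructor
  · rintro ⟨x, hx⟩
    refine ⟨(unflip x).unop, ?_⟩
    have := congrArg (fun c => (unflip c).unop) hx
    simpa [unflip_flip] using this
  · rintro ⟨x, rfl⟩
    exact ⟨(flip x).unop, by simp⟩

theorem exists_flip (a : IntervalMonoid Pᵒᵈ) : ∃ b : IntervalMonoid P, (flip b).unop = a :=
  ⟨_, flip_unflip a⟩

theorem CondSup.dual (h : CondSup P) : CondInf Pᵒᵈ := fun a b c hca hcb => by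
  obtain ⟨d, hd⟩ := h (OrderDual.ofDual a) (OrderDual.ofDual b) (OrderDual.ofDual c) hca hcb
  exact ⟨OrderDual.toDual d, hd.dual⟩

theorem exists_rightGcd (hP : CondSup P) (a b : IntervalMonoid P) : ∃ d, IsRightGcd a b d := by
  obtain ⟨d, h1, h2, h3⟩ := exists_leftGcd hP.dual (flip a).unop (flip b).unop
  obtain ⟨d, rfl⟩ := exists_flip d
  rw [leftDvd_flip_iff] at h1 h2
  exact ⟨d, h1, h2, fun e h4 h5 =>
    leftDvd_flip_iff.1 (h3 _ (leftDvd_flip_iff.2 h4) (leftDvd_flip_iff.2 h5))⟩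

theorem isLeftLcm_iv {p q r u : P} (hq : q < p) (hr : r < p) (hu : IsGLB {q, r} u) :
    IsLeftLcm (iv q p) (iv r p) (iv u p) := by
  have hup : u ≤ p := (hu.1 (by simp) : u ≤ q).trans hq.le
  obtain ⟨h1, h2, h3⟩ := isRightLcm_iv (OrderDual.toDual_lt_toDual.2 hq)
    (OrderDual.toDual_lt_toDual.2 hr) (u := OrderDual.toDual u) hu.dual
  rw [← flip_iv hq.le, ← flip_iv hup, leftDvd_flip_iff] at h1
  rw [← flip_iv hr.le, ← flip_iv hup, leftDvd_flip_iff] at h2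
  rw [← flip_iv hq.le, ← flip_iv hup, ← flip_iv hr.le] at h3
  exact ⟨h1, h2, fun e h4 h5 =>
    leftDvd_flip_iff.1 (h3 _ (leftDvd_flip_iff.2 h4) (leftDvd_flip_iff.2 h5))⟩

theorem isGcdMonoid_intervalMonoid (h : CondInf P) (h' : CondSup P) :
    IsGcdMonoid (IntervalMonoid P) where
  mul_left_cancel := intervalMonoid_mul_left_cancel
  mul_right_cancel := intervalMonoid_mul_right_cancel
  eq_one_of_isUnit a ha := by
    obtain ⟨b, hb, -⟩ := isUnit_iff_exists.1 ha
    exact eq_one_of_mul_eq_one hb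
  exists_leftGcd := exists_leftGcd h
  exists_rightGcd := exists_rightGcd h'

end Duality

/-! ### Additive lengths and noetherianity. -/

section Length

variable {P : Type*} [PartialOrder P]

/-- The length on the interval monoid of a poset graded by `h`. -/
def ivLen (h : P → ℕ) (hh : StrictMono h) : IntervalMonoid P →* Multiplicative ℕ :=
  ivLift (fun p q => Multiplicative.ofAdd (h q - h p)) (by simp) (by
    intro p q r hpq hqr
    have h1 := hh.monotone hpq
    have h2 := hh.monotone hqr
    rw [← ofAdd_add]
    congr 1
    omega)

theorem eq_one_of_ivLen (h : P → ℕ) (hh : StrictMono h) {a : IntervalMonoid P}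
    (ha : (ivLen h hh a).toAdd = 0) : a = 1 := by
  obtain ⟨l, hl, rfl⟩ := exists_nf a
  match l with
  | [] => rfl
  | (p, q) :: l =>
    exfalso
    rw [nfProd_cons, map_mul, toAdd_mul, ivLen, ivLift_iv _ _ _ hl.lt.le] at ha
    have := hh hl.lt
    simp at ha
    omega

end Length

/-- A length on a monoid: an additive map to `ℕ` that vanishes only at `1`. -/
structure IsLength {M : Type*} [Monoid M] (len : M → ℕ) : Prop where
  mul : ∀ a b, len (a * b) = len a + len b
  eq_one : ∀ a, len a = 0 → a = 1

theorem IsLength.pos {M : Type*} [Monoid M] {len : M → ℕ} (h : IsLength len) {a : M}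
    (ha : a ≠ 1) : 0 < len a :=
  Nat.pos_of_ne_zero fun h0 => ha (h.eq_one a h0)

theorem exists_isLength {P : Type*} [PartialOrder P] {h : P → ℕ} (hh : StrictMono h) :
    ∃ len : IntervalMonoid P → ℕ, IsLength len :=
  ⟨fun a => (ivLen h hh a).toAdd, fun a b => by rw [map_mul, toAdd_mul],
    fun _ ha => eq_one_of_ivLen h hh ha⟩

theorem IsLength.isNoetherianMonoid {M : Type*} [Monoid M] {len : M → ℕ} (h : IsLength len) :
    IsNoetherianMonoid M where
  wf_left := by
    refine Subrelation.wf ?_ (InvImage.wf len Nat.lt_wfRel.wf)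
    rintro a b ⟨⟨x, rfl⟩, hne⟩
    have hx : x ≠ 1 := fun hx => hne (by rw [hx, mul_one])
    have := h.pos hx
    change len a < len (a * x)
    rw [h.mul]
    omega
  wf_right := by
    refine Subrelation.wf ?_ (InvImage.wf len Nat.lt_wfRel.wf)
    rintro a b ⟨⟨x, rfl⟩, hne⟩
    have hx : x ≠ 1 := fun hx => hne (by rw [hx, one_mul])
    have := h.pos hx
    change len a < len (x * a)
    rw [h.mul]
    omega

end MFR

namespace MFR

/-! ### Reduction: invariance of the value, termination, applicability of the rules. -/

section Multifractions

variable {M : Type*} [Monoid M]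

theorem RedRule.map_fst {x : M} {L L' : List (Bool × M)} (h : RedRule x L L') :
    L'.map Prod.fst = L.map Prod.fst := by
  cases h <;> simp

theorem Multifraction.exists_red {a : Multifraction M} {x : M} (hx : x ≠ 1)
    {L' : List (Bool × M)} (h : RedRule x a.entries L') : ∃ b, a.Red b := by
  refine ⟨⟨L', ?_⟩, x, hx, h⟩
  have h1 := a.alternating
  rw [← List.isChain_map (R := fun s t : Bool => s ≠ t) Prod.fst] at h1 ⊢
  rwa [h.map_fst]

/-- The value of a signed sequence under a morphism to a group. -/
def signedProd {G : Type*} [Group G] (f : M →* G) (L : List (Bool × M)) : G :=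
  (L.map fun s => if s.1 = true then f s.2 else (f s.2)⁻¹).prod

theorem RedRule.signedProd_eq {G : Type*} [Group G] (f : M →* G) {x : M}
    {L L' : List (Bool × M)} (h : RedRule x L L') : signedProd f L' = signedProd f L := by
  have hmul : ∀ {a b c d : M}, a * b = c * d → f a * f b = f c * f d := fun h => by
    rw [← map_mul, h, map_mul]
  cases h with
  | pos p q a₁ a₂ a₃ b₁ b₂ b₃ x' h₁ h₂ hlcm h₃ =>
    have h := eq_mul_inv_of_mul_eq (hmul h₂)
    subst h₁ h₃
    simp [signedProd, h, mul_assoc]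
  | neg p q a₁ a₂ a₃ b₁ b₂ b₃ x' h₁ h₂ hlcm h₃ =>
    have h := eq_inv_mul_of_mul_eq (hmul h₂)
    subst h₁ h₃
    simp [signedProd, h, mul_assoc]
  | pos_one q a₁ a₂ b₁ b₂ h₁ h₂ =>
    subst h₁ h₂
    simp [signedProd, mul_assoc]
  | neg_one q a₁ a₂ b₁ b₂ h₁ h₂ =>
    subst h₁ h₂
    simp [signedProd, mul_assoc]

theorem Multifraction.Red.eval_eq {a b : Multifraction M} (h : a.Red b) : b.eval = a.eval := by
  obtain ⟨x, -, h⟩ := h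
  exact h.signedProd_eq (toEnvelopingGroup M)

theorem Multifraction.Reds.eval_eq {a b : Multifraction M} (h : a.Reds b) : b.eval = a.eval := by
  induction h with
  | refl => rfl
  | tail _ h ih => exact h.eval_eq.trans ih

theorem Multifraction.Trivial.unital {a : Multifraction M} (h : a.Trivial) : a.Unital := by
  refine List.prod_eq_one fun g hg => ?_
  obtain ⟨s, hs, rfl⟩ := List.mem_map.1 hg
  simp [h s hs]

/-- The enveloping group is universal. -/
theorem exists_envelopingGroup_lift {G : Type*} [Group G] (f : M →* G) :
    ∃ g : EnvelopingGroup M →* G, ∀ a, g (toEnvelopingGroup M a) = f a := by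
  refine ⟨PresentedGroup.toGroup (f := f) ?_, fun a => PresentedGroup.toGroup.of _⟩
  rintro r ⟨a, b, rfl⟩
  simp

theorem Multifraction.Unital.signedProd_eq_one {G : Type*} [Group G] (f : M →* G)
    {a : Multifraction M} (h : a.Unital) : signedProd f a.entries = 1 := by
  obtain ⟨g, hg⟩ := exists_envelopingGroup_lift f
  have h1 := congrArg g (show a.eval = 1 from h)
  rw [map_one, Multifraction.eval, map_list_prod, List.map_map] at h1
  rw [signedProd, ← h1]
  congr 1
  refine List.map_congr_left fun s _ => ?_
  by_cases hs : s.1 = true <;> simp [hs, hg]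

/-- A rule at level `i` shortens the entry at level `i + 1` and does not touch later ones. Read from
the right, the sequence of lengths decreases lexicographically, whatever happens to the entries at
`i - 1` and `i`; the depth is constant. -/
theorem RedRule.shortlex {len : M → ℕ} (hlen : IsLength len) {x : M} (hx : x ≠ 1)
    {L L' : List (Bool × M)} (h : RedRule x L L') :
    List.Shortlex (· < ·) (L'.map fun s => len s.2).reverse
      (L.map fun s => len s.2).reverse := by
  have hpos := hlen.pos hx
  cases h with
  | pos p q a₁ a₂ a₃ b₁ b₂ b₃ x' h₁ h₂ hlcm h₃ =>
    have : len b₃ < len a₃ := by rw [← h₃, hlen.mul]; omega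
    refine List.Shortlex.of_lex (by simp) ?_
    simp only [List.map_append, List.map_cons, List.reverse_append, List.reverse_cons,
      List.append_assoc, List.cons_append, List.nil_append]
    exact List.Lex.append_left _ (List.Lex.rel this) _
  | neg p q a₁ a₂ a₃ b₁ b₂ b₃ x' h₁ h₂ hlcm h₃ =>
    have : len b₃ < len a₃ := by rw [← h₃, hlen.mul]; omega
    refine List.Shortlex.of_lex (by simp) ?_
    simp only [List.map_append, List.map_cons, List.reverse_append, List.reverse_cons,
      List.append_assoc, List.cons_append, List.nil_append]
    exact List.Lex.append_left _ (List.Lex.rel this) _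
  | pos_one q a₁ a₂ b₁ b₂ h₁ h₂ =>
    have : len b₂ < len a₂ := by rw [← h₂, hlen.mul]; omega
    refine List.Shortlex.of_lex (by simp) ?_
    simp only [List.map_cons, List.reverse_cons,
      List.append_assoc, List.cons_append, List.nil_append]
    exact List.Lex.append_left _ (List.Lex.rel this) _
  | neg_one q a₁ a₂ b₁ b₂ h₁ h₂ =>
    have : len b₂ < len a₂ := by rw [← h₂, hlen.mul]; omega
    refine List.Shortlex.of_lex (by simp) ?_
    simp only [List.map_cons, List.reverse_cons,
      List.append_assoc, List.cons_append, List.nil_append]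
    exact List.Lex.append_left _ (List.Lex.rel this) _

theorem wellFounded_red {len : M → ℕ} (hlen : IsLength len) :
    WellFounded fun b a : Multifraction M => a.Red b := by
  refine Subrelation.wf ?_ (InvImage.wf
    (fun a : Multifraction M => (a.entries.map fun s => len s.2).reverse)
    (List.Shortlex.wf (r := fun m n : ℕ => m < n) Nat.lt_wfRel.wf))
  rintro b a ⟨x, hx, h⟩
  exact h.shortlex hlen hx

theorem semiConvergent_of_exists_red {len : M → ℕ} (hlen : IsLength len)
    (h : ∀ a : Multifraction M, a.Unital → ¬ a.Trivial → ∃ b, a.Red b) : SemiConvergent M := by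
  intro a
  constructor
  · induction a using (wellFounded_red hlen).induction with
    | h a ih =>
      intro ha
      by_cases ht : a.Trivial
      · exact ⟨a, ht, .refl⟩
      · obtain ⟨b, hb⟩ := h a ha ht
        obtain ⟨c, hc, hbc⟩ := ih b hb (hb.eval_eq.trans ha)
        exact ⟨c, hc, .head hb hbc⟩
  · rintro ⟨b, hb, hab⟩
    exact hab.eval_eq.symm.trans hb.unital

/-- Divisibility on the right end for positive entries, on the left end for negative ones. -/
def EndDvd : Bool → M → M → Prop
  | true => RightDvd
  | false => LeftDvd

/-- Left lcms for positive entries, right lcms for negative ones. -/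
def IsEndLcm : Bool → M → M → M → Prop
  | true => IsLeftLcm
  | false => IsRightLcm

theorem isEndLcm_of_endDvd {σ : Bool} {x a : M} (h : EndDvd σ x a) : IsEndLcm σ x a a := by
  cases σ
  · exact ⟨h, ⟨1, mul_one a⟩, fun e _ he => he⟩
  · exact ⟨h, ⟨1, one_mul a⟩, fun e _ he => he⟩

/-- At a level with a left neighbour, the only conditions on `x` are an lcm with the entry `a₂` and
divisibility of the next entry. The left neighbour merely absorbs the cofactor. -/
theorem exists_redRule_of_lcm {σ : Bool} {x a₁ a₂ a₃ m : M} (p q : List (Bool × M))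
    (hm : IsEndLcm σ x a₂ m) (h : EndDvd σ x a₃) :
    ∃ L', RedRule x (p ++ (!σ, a₁) :: (σ, a₂) :: (!σ, a₃) :: q) L' := by
  cases σ
  · obtain ⟨b₃, h₃⟩ : LeftDvd x a₃ := h
    have hm' : IsRightLcm x a₂ m := hm
    obtain ⟨⟨b₂, h₂⟩, ⟨x', h₁⟩, -⟩ := hm
    exact ⟨_, .neg p q a₁ a₂ a₃ _ b₂ b₃ x' rfl (h₂.trans h₁.symm) (h₁.symm ▸ hm') h₃⟩
  · obtain ⟨b₃, h₃⟩ := h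
    have hm' : IsLeftLcm x a₂ m := hm
    obtain ⟨⟨b₂, h₂⟩, ⟨x', h₁⟩, -⟩ := hm
    exact ⟨_, .pos p q a₁ a₂ a₃ _ b₂ b₃ x' rfl (h₂.trans h₁.symm) (h₁.symm ▸ hm') h₃⟩

/-- A common divisor of adjacent entries can always be removed: at level one this is the special
rule, and at higher levels the lcm of `x` and `a` is `a` itself. -/
theorem exists_redRule_of_dvd {σ : Bool} {x a b : M} (p q : List (Bool × M))
    (halt : (p ++ (σ, a) :: (!σ, b) :: q).IsChain fun s t => s.1 ≠ t.1)
    (ha : EndDvd σ x a) (hb : EndDvd σ x b) :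
    ∃ L', RedRule x (p ++ (σ, a) :: (!σ, b) :: q) L' := by
  rcases List.eq_nil_or_concat p with rfl | ⟨p, s, rfl⟩
  · cases σ <;> obtain ⟨a', ha⟩ := ha <;> obtain ⟨b', hb⟩ := hb
    · exact ⟨_, .neg_one q a b a' b' ha hb⟩
    · exact ⟨_, .pos_one q a b a' b' ha hb⟩
  · obtain ⟨τ, c⟩ := s
    rw [List.concat_eq_append, List.append_assoc, List.singleton_append] at halt ⊢
    have hτ : τ = !σ := by
      have h2 := (List.isChain_append.1 halt).2.1
      have := (List.isChain_cons_cons.1 h2).1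
      cases σ <;> cases τ <;> simp_all
    subst hτ
    exact exists_redRule_of_lcm p q (isEndLcm_of_endDvd ha) hb

/-- Across a trivial entry, the whole of the next entry can be pushed to the left. -/
theorem exists_redRule_of_one {σ : Bool} (a₁ a₃ : M) (p q : List (Bool × M)) :
    ∃ L', RedRule a₃ (p ++ (!σ, a₁) :: (σ, 1) :: (!σ, a₃) :: q) L' := by
  refine exists_redRule_of_lcm (m := a₃) p q ?_ ?_
  · cases σ
    · exact ⟨⟨1, mul_one _⟩, ⟨a₃, one_mul _⟩, fun e he _ => he⟩
    · exact ⟨⟨1, one_mul _⟩, ⟨a₃, mul_one _⟩, fun e he _ => he⟩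
  · cases σ
    · exact ⟨1, mul_one _⟩
    · exact ⟨1, one_mul _⟩

end Multifractions

/-! ### Locating a block of letters inside a concatenation of entries. -/

section Matching

variable {α β : Type*}

/-- The list `B` reads off the entries of `L` one by one: all its letters but the last one are
full entries, and the last one is the beginning of an entry. -/
inductive Fits (exp : α → List β) : List β → List α → Prop
  | last (b : β) (l : List β) (e : α) (L : List α) (h : exp e = b :: l) : Fits exp [b] (e :: L)
  | cons (b : β) (B : List β) (e : α) (L : List α) (h : exp e = [b]) (hB : Fits exp B L) :
      Fits exp (b :: B) (e :: L)

/-- The relation `R` holds between neighbours in `B` but never inside an entry, so each letter of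
`B` opens a new entry. By `hL`, an empty entry is followed by empty ones only, so none can
intervene. -/
theorem fits_of_append_eq {exp : α → List β} {R : β → β → Prop} {B C : List β} {L : List α}
    (hn : B ≠ []) (hB : B.IsChain R) (hexp : ∀ e, (exp e).IsChain fun b c => ¬ R b c)
    (hL : L.Pairwise fun e f => exp e = [] → exp f = []) (h : B ++ C = L.flatMap exp) :
    Fits exp B L := by
  induction L generalizing B with
  | nil => simp at h; exact absurd h.1 hn
  | cons e L ih =>
    rw [List.pairwise_cons] at hL
    rw [List.flatMap_cons] at h
    match B, hn with
    | b :: B, _ =>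
      cases he : exp e with
      | nil =>
        have : L.flatMap exp = [] := List.flatMap_eq_nil_iff.2 fun f hf => hL.1 f hf he
        rw [he, this] at h
        simp at h
      | cons c l =>
        rw [he] at h
        simp only [List.cons_append, List.cons.injEq] at h
        obtain ⟨rfl, h⟩ := h
        match B with
        | [] => exact .last _ _ _ _ he
        | b' :: B =>
          cases l with
          | nil => exact .cons _ _ _ _ he (ih (by simp) hB.of_cons hL.2 h)
          | cons c' l =>
            simp only [List.cons_append, List.cons.injEq] at h
            have h1 := hexp e
            rw [he] at h1
            exact absurd (h.1 ▸ (List.isChain_cons_cons.1 hB).1) (List.isChain_cons_cons.1 h1).1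

/-- For a block starting anywhere, the first letter must close its entry. The first entry of `L` is
exempt from the condition on empty entries: if it is empty, the block simply starts later. -/
theorem exists_fits {exp : α → List β} {R : β → β → Prop} {A B C : List β} {b₁ b₂ : β}
    {L : List α} (hB : (b₁ :: b₂ :: B).IsChain R)
    (hexp : ∀ e, (exp e).IsChain fun b c => ¬ R b c)
    (hL : L.tail.Pairwise fun e f => exp e = [] → exp f = [])
    (h : A ++ (b₁ :: b₂ :: B ++ C) = L.flatMap exp) :
    ∃ pre e L', L = pre ++ e :: L' ∧ (∃ u, exp e = u ++ [b₁]) ∧ Fits exp (b₂ :: B) L' := by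
  induction L generalizing A with
  | nil => simp at h
  | cons e L ih =>
    rw [List.tail_cons] at hL
    rw [List.flatMap_cons] at h
    have later : ∀ A' : List β, A' ++ (b₁ :: b₂ :: B ++ C) = L.flatMap exp →
        ∃ pre e' L', e :: L = pre ++ e' :: L' ∧ (∃ u, exp e' = u ++ [b₁]) ∧
          Fits exp (b₂ :: B) L' := fun A' h' => by
      obtain ⟨pre, e', L', rfl, h2⟩ := ih (hL.sublist (List.tail_sublist L)) h'
      exact ⟨e :: pre, e', L', rfl, h2⟩
    rcases List.append_eq_append_iff.1 h with ⟨a', he, h'⟩ | ⟨c', rfl, h'⟩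
    · match a' with
      | [] => exact later [] h'
      | [a] =>
        simp only [List.cons_append, List.nil_append, List.cons.injEq] at h'
        obtain ⟨rfl, h'⟩ := h'
        exact ⟨[], e, L, rfl, ⟨A, he⟩, fits_of_append_eq (by simp) hB.of_cons hexp hL h'⟩
      | a :: a₂ :: a' =>
        simp only [List.cons_append, List.cons.injEq] at h'
        obtain ⟨rfl, rfl, -⟩ := h'
        have h1 := hexp e
        rw [he] at h1
        have h2 := (List.isChain_append.1 h1).2.1
        exact absurd (List.isChain_cons_cons.1 hB).1 (List.isChain_cons_cons.1 h2).1
    · exact later c' h'.symm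

end Matching

end MFR

namespace MFR

/-! ### From unital irreducible multifractions to closed irreducible zigzags. -/

section Zigzags

variable {P : Type*} [PartialOrder P]

/-- `p < q` or `p > q` according to the sign. -/
def SLt : Bool → P → P → Prop
  | true, p, q => p < q
  | false, p, q => q < p

/-- `p ≤ q` or `p ≥ q` according to the sign. -/
def SLe : Bool → P → P → Prop
  | true, p, q => p ≤ q
  | false, p, q => q ≤ p

/-- The turn `p, q, r` of a zigzag allows a reduction that pushes an interval across the step
`p, q`. -/
def TurnRed (σ : Bool) (p q r : P) : Prop :=
  ∃ s t, SLe σ r s ∧ SLt σ s q ∧ SLe σ t p ∧ SLe σ t s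

/-- The two steps of the turn `p, q, r` of a zigzag overlap. -/
def TurnOverlap (σ : Bool) (p q r : P) : Prop :=
  ∃ s, SLe σ r s ∧ SLt σ s q ∧ SLe σ p s

/-- `p, q, l` is a zigzag, starting with a step of sign `σ`, none of whose turns is reducible. -/
def IrredZigzag : Bool → P → P → List P → Prop
  | _, _, _, [] => True
  | σ, p, q, r :: l => SLt (!σ) q r ∧ ¬ TurnRed σ p q r ∧ IrredZigzag (!σ) q r l

variable (P) in
/-- Every closed zigzag has a reducible turn; at the first turn only overlaps count. -/
def ClosedZigzagsReducible : Prop :=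
  ∀ (σ : Bool) (p q r : P) (l : List P), SLt σ p q → SLt (!σ) q r → ¬ TurnOverlap σ p q r →
    IrredZigzag (!σ) q r l → (r :: l).getLast (by simp) ≠ p

/-- The interval between two comparable elements, read upwards. -/
noncomputable def siv : Bool → P → P → IntervalMonoid P
  | true, p, q => iv p q
  | false, p, q => iv q p

theorem endDvd_mul_iv {σ : Bool} {p q : P} {a : IntervalMonoid P}
    (h : ∃ u, a = if σ = true then u * iv p q else iv q p * u) {s : P} (hp : SLe σ p s)
    (hs : SLt σ s q) : EndDvd σ (siv σ s q) a := by
  obtain ⟨u, rfl⟩ := h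
  cases σ
  · exact ⟨iv s p * u, by
      rw [if_neg (by simp), siv]
      exact iv_mul_assoc (le_of_lt hs) hp u⟩
  · refine ⟨u * iv p s, ?_⟩
    rw [if_pos rfl, mul_assoc, siv, iv_mul hp (le_of_lt hs)]

theorem exists_isEndLcm_siv (hinf : CondInf P) (hsup : CondSup P) {σ : Bool} {p q s t : P}
    (hp : SLt σ p q) (hs : SLt σ s q) (htp : SLe σ t p) (hts : SLe σ t s) :
    ∃ m, IsEndLcm σ (siv σ s q) (siv σ p q) m := by
  cases σ
  · obtain ⟨u, hu⟩ := hsup s p t hts htp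
    exact ⟨_, isRightLcm_iv hs hp hu⟩
  · obtain ⟨u, hu⟩ := hinf s p t hts htp
    exact ⟨_, isLeftLcm_iv hs hp hu⟩

theorem siv_ne_one {σ : Bool} {p q : P} (h : SLt σ p q) : siv σ p q ≠ 1 := by
  cases σ
  · exact iv_ne_one h
  · exact iv_ne_one h

/-- The normal form of an element. -/
noncomputable def nf (a : IntervalMonoid P) : List (P × P) := (exists_nf a).choose

theorem isNF_nf (a : IntervalMonoid P) : IsNF (nf a) := (exists_nf a).choose_spec.1

theorem nfProd_nf (a : IntervalMonoid P) : nfProd (nf a) = a := (exists_nf a).choose_spec.2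

/-- The steps of a signed element: the intervals of its normal form, read along the sign. -/
noncomputable def steps (s : Bool × IntervalMonoid P) : List (P × P) :=
  if s.1 = true then nf s.2 else ((nf s.2).map Prod.swap).reverse

theorem pairProd_steps (s : Bool × IntervalMonoid P) :
    pairProd (steps s) = if s.1 = true then toFree P s.2 else (toFree P s.2)⁻¹ := by
  have : toFree P s.2 = pairProd (nf s.2) := by rw [← toFree_nfProd (isNF_nf _), nfProd_nf]
  rw [this, steps]
  split_ifs
  · rfl
  · exact pairProd_reverse_swap _

theorem pairProd_flatMap_steps (L : List (Bool × IntervalMonoid P)) :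
    pairProd (L.flatMap steps) = signedProd (toFree P) L := by
  induction L with
  | nil => rfl
  | cons s L ih =>
    rw [List.flatMap_cons, pairProd_append, ih, pairProd_steps]
    simp [signedProd]

theorem isChain_steps (s : Bool × IntervalMonoid P) :
    (steps s).IsChain fun e f => ¬ e.2 = f.1 := by
  have h := (isNF_nf s.2).2
  rw [steps]
  split_ifs
  · exact h
  · rw [List.isChain_reverse, List.isChain_map]
    exact h.imp fun e f hef => fun h' => hef h'.symm

theorem slt_of_mem_steps {s : Bool × IntervalMonoid P} {e : P × P} (h : e ∈ steps s) :
    SLt s.1 e.1 e.2 := by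
  obtain ⟨σ, a⟩ := s
  cases σ
  · simp only [steps, Bool.false_eq_true, if_false, List.mem_reverse, List.mem_map] at h
    obtain ⟨f, hf, rfl⟩ := h
    exact (isNF_nf a).1 f hf
  · exact (isNF_nf a).1 e h

theorem steps_eq_nil_iff {s : Bool × IntervalMonoid P} : steps s = [] ↔ s.2 = 1 := by
  have : nf s.2 = [] ↔ s.2 = 1 := by
    constructor
    · intro h
      rw [← nfProd_nf s.2, h, nfProd_nil]
    · intro h
      exact (isNF_nf s.2).inj IsNF.nil (by rw [nfProd_nf, h, nfProd_nil])
  rw [← this, steps]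
  split_ifs <;> simp

/-- An element is the product of its steps. -/
theorem eq_of_steps {s : Bool × IntervalMonoid P} {l : List (P × P)} (h : steps s = l) :
    s.2 = if s.1 = true then nfProd l else nfProd (l.map Prod.swap).reverse := by
  subst h
  rw [steps]
  split_ifs
  · exact (nfProd_nf _).symm
  · simp [nfProd_nf]

theorem eq_siv_of_steps {s : Bool × IntervalMonoid P} {b : P × P} (h : steps s = [b]) :
    s.2 = siv s.1 b.1 b.2 := by
  have h1 := eq_of_steps h
  obtain ⟨σ, a⟩ := s
  cases σ <;> simpa [siv] using h1

theorem eq_mul_of_steps_concat {s : Bool × IntervalMonoid P} {b : P × P} {l : List (P × P)}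
    (h : steps s = l ++ [b]) :
    ∃ u, s.2 = if s.1 = true then u * iv b.1 b.2 else iv b.2 b.1 * u := by
  have h1 := eq_of_steps h
  obtain ⟨σ, a⟩ := s
  cases σ
  · exact ⟨_, by simpa using h1⟩
  · exact ⟨nfProd l, by simpa [nfProd_append] using h1⟩

theorem eq_mul_of_steps_cons {s : Bool × IntervalMonoid P} {b : P × P} {l : List (P × P)}
    (h : steps s = b :: l) :
    ∃ u, s.2 = if (!s.1) = true then u * iv b.2 b.1 else iv b.1 b.2 * u := by
  have h1 := eq_of_steps h
  obtain ⟨σ, a⟩ := s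
  cases σ
  · exact ⟨nfProd (l.map Prod.swap).reverse, by simpa [nfProd_append] using h1⟩
  · exact ⟨_, by simpa using h1⟩

theorem Fits.exists_cons {L : List (Bool × IntervalMonoid P)} {b : P × P} {B : List (P × P)}
    (h : Fits steps (b :: B) L) : ∃ s l L', L = s :: L' ∧ steps s = b :: l := by
  cases h with
  | last _ l e L h => exact ⟨e, l, L, rfl, h⟩
  | cons _ _ e L h _ => exact ⟨e, [], L, rfl, h⟩

/-- `L` admits no reduction. -/
def IrredEntries (L : List (Bool × IntervalMonoid P)) : Prop :=
  ∀ x L', x ≠ 1 → ¬ RedRule x L L'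

theorem sign_eq_not {M : Type*} {p q : List (Bool × M)} {s t : Bool × M}
    (h : (p ++ s :: t :: q).IsChain fun s t => s.1 ≠ t.1) : t.1 = !s.1 := by
  have := (List.isChain_cons_cons.1 (List.isChain_append.1 h).2.1).1
  revert this
  cases s.1 <;> cases t.1 <;> simp

/-- The entry `s₁` serves only as the left neighbour that the rule at the level of `s₂` needs. The
step `b` is the whole entry `s₂` unless the zigzag ends there, so an lcm with `b` is an lcm with the
entry. -/
theorem IrredEntries.irredZigzag (hinf : CondInf P) (hsup : CondSup P)
    {pre L : List (Bool × IntervalMonoid P)} {s₁ s₂ : Bool × IntervalMonoid P}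
    (hirr : IrredEntries (pre ++ s₁ :: s₂ :: L))
    (halt : (pre ++ s₁ :: s₂ :: L).IsChain fun s t => s.1 ≠ t.1)
    {b : P × P} {B : List (P × P)} (hB : (b :: B).IsChain fun e f => e.2 = f.1)
    (hfit : Fits steps (b :: B) (s₂ :: L)) :
    IrredZigzag s₂.1 b.1 b.2 (B.map Prod.snd) := by
  induction B generalizing pre s₁ s₂ b L with
  | nil => trivial
  | cons b₃ B ih =>
    cases hfit with
    | cons _ _ _ _ hs₂ hfit =>
      obtain ⟨s₃, l, L, rfl, hs₃⟩ := hfit.exists_cons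
      have hb : b.2 = b₃.1 := (List.isChain_cons_cons.1 hB).1
      have h12 := sign_eq_not halt
      have h23 : s₃.1 = !s₂.1 := sign_eq_not (p := pre ++ [s₁]) (s := s₂) (t := s₃) (q := L)
        (by simpa using halt)
      have h3 : SLt s₃.1 b₃.1 b₃.2 := slt_of_mem_steps (hs₃ ▸ List.mem_cons_self)
      have h2 : SLt s₂.1 b.1 b.2 := slt_of_mem_steps (hs₂ ▸ List.mem_cons_self)
      rw [List.map_cons, IrredZigzag]
      refine ⟨?_, ?_, ?_⟩
      · rw [hb, ← h23]; exact h3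
      -- The interval between `s` and `q` divides the next entry because `s` lies between `q` and
      -- `r`. It has an lcm with the present entry because `t` bounds both `p` and `s`.
      · rintro ⟨s, t, hrs, hsq, htp, hts⟩
        obtain ⟨m, hm⟩ := exists_isEndLcm_siv hinf hsup h2 hsq htp hts
        have hd : EndDvd s₂.1 (siv s₂.1 s b.2) s₃.2 := by
          refine endDvd_mul_iv ?_ hrs hsq
          have := eq_mul_of_steps_cons hs₃
          rwa [h23, Bool.not_not, ← hb] at this
        rw [← eq_siv_of_steps hs₂] at hm
        obtain ⟨L', hL'⟩ := exists_redRule_of_lcm (a₁ := s₁.2) pre L hm hd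
        refine hirr _ L' (siv_ne_one hsq) ?_
        convert hL' using 2
        have e1 : s₁ = (!s₂.1, s₁.2) := by rw [h12, Bool.not_not]
        have e3 : s₃ = (!s₂.1, s₃.2) := by rw [← h23]
        rw [← e1, ← e3]
      · have h4 := ih (pre := pre ++ [s₁]) (s₁ := s₂) (s₂ := s₃) (b := b₃) (L := L)
          (by simpa using hirr) (by simpa using halt) hB.of_cons hfit
        rwa [h23, ← hb] at h4

/-- Otherwise some trivial entry with a left neighbour would be followed by a nontrivial one, which
could be pushed across it. The first entry has no left neighbour, hence the `tail`. -/
theorem IrredEntries.pairwise_tail {L : List (Bool × IntervalMonoid P)} (hirr : IrredEntries L)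
    (halt : L.IsChain fun s t => s.1 ≠ t.1) :
    L.tail.Pairwise fun s t => steps s = [] → steps t = [] := by
  have : IsTrans (Bool × IntervalMonoid P) fun s t => steps s = [] → steps t = [] :=
    ⟨fun _ _ _ h h' => h' ∘ h⟩
  rw [← List.isChain_iff_pairwise]
  have key : ∀ (pre : List (Bool × IntervalMonoid P)) (s : Bool × IntervalMonoid P)
      (T : List (Bool × IntervalMonoid P)), L = pre ++ s :: T →
        T.IsChain fun s t => steps s = [] → steps t = [] := by
    intro pre s T
    induction T generalizing pre s with
    | nil => simp
    | cons s₂ T ih =>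
      intro hL
      have ih' := ih (pre ++ [s]) s₂ (by simpa using hL)
      cases T with
      | nil => simp
      | cons s₃ T =>
        refine List.isChain_cons_cons.2 ⟨fun h => ?_, ih'⟩
        rw [steps_eq_nil_iff] at h ⊢
        by_contra h3
        subst hL
        have h12 := sign_eq_not halt
        have h23 : s₃.1 = !s₂.1 := sign_eq_not (p := pre ++ [s]) (s := s₂) (t := s₃) (q := T)
          (by simpa using halt)
        obtain ⟨L', hL'⟩ := exists_redRule_of_one (σ := s₂.1) s.2 s₃.2 pre T
        refine hirr _ L' h3 ?_
        convert hL' using 2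
        have e1 : s = (!s₂.1, s.2) := by rw [h12, Bool.not_not]
        have e2 : s₂ = (s₂.1, 1) := by rw [← h]
        have e3 : s₃ = (!s₂.1, s₃.2) := by rw [← h23]
        rw [← e1, ← e3, ← e2]
  cases L with
  | nil => simp
  | cons s T => exact key [] s T rfl

theorem exists_redRule_of_signedProd_eq_one (hinf : CondInf P) (hsup : CondSup P)
    (hP : ClosedZigzagsReducible P) {L : List (Bool × IntervalMonoid P)}
    (halt : L.IsChain fun s t => s.1 ≠ t.1) (h1 : signedProd (toFree P) L = 1)
    (hne : ∃ s ∈ L, s.2 ≠ 1) : ∃ x L', x ≠ 1 ∧ RedRule x L L' := by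
  by_contra hcon
  have hirr : IrredEntries L := fun x L' hx h => hcon ⟨x, L', hx, h⟩
  rw [← pairProd_flatMap_steps] at h1
  have hnil : L.flatMap steps ≠ [] := by
    obtain ⟨s, hs, hs1⟩ := hne
    intro h
    exact hs1 (steps_eq_nil_iff.1 (List.flatMap_eq_nil_iff.1 h s hs))
  obtain ⟨A, B, C, hB0, hL, hB, hclosed⟩ := exists_closed_block hnil h1
  match B, hB0 with
  | [b], _ =>
    have hb : b ∈ L.flatMap steps := by rw [hL]; simp
    obtain ⟨s, -, hs⟩ := List.mem_flatMap.1 hb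
    have := slt_of_mem_steps hs
    simp only [List.head_cons, List.getLast_singleton] at hclosed
    rw [hclosed] at this
    cases h : s.1 <;> rw [h] at this <;> exact lt_irrefl _ this
  | b₁ :: b₂ :: B, _ =>
    obtain ⟨pre, s₁, L', rfl, ⟨u, hu⟩, hfit⟩ := exists_fits hB isChain_steps
      (hirr.pairwise_tail halt) (A := A) (C := C) (by rw [hL, List.append_assoc])
    obtain ⟨s₂, l, L', rfl, hs₂⟩ := hfit.exists_cons
    have h12 : s₂.1 = !s₁.1 := sign_eq_not halt
    have hb : b₁.2 = b₂.1 := (List.isChain_cons_cons.1 hB).1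
    have hlt1 : SLt s₁.1 b₁.1 b₁.2 := slt_of_mem_steps (hu ▸ by simp)
    have hlt2 : SLt s₂.1 b₂.1 b₂.2 := slt_of_mem_steps (hs₂ ▸ List.mem_cons_self)
    have hz := hirr.irredZigzag hinf hsup halt hB.of_cons hfit
    rw [h12, ← hb] at hz hlt2
    refine hP s₁.1 b₁.1 b₁.2 b₂.2 (B.map Prod.snd) hlt1 hlt2 ?_ hz ?_
    -- The first step is only the end of its entry `s₁`, so an lcm with the whole entry is not
    -- available. An overlap, however, gives a common divisor of `s₁` and `s₂`.
    · rintro ⟨s, hrs, hsq, hps⟩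
      have hd1 : EndDvd s₁.1 (siv s₁.1 s b₁.2) s₁.2 :=
        endDvd_mul_iv (eq_mul_of_steps_concat hu) hps hsq
      have hd2 : EndDvd s₁.1 (siv s₁.1 s b₁.2) s₂.2 := by
        refine endDvd_mul_iv ?_ hrs hsq
        have := eq_mul_of_steps_cons hs₂
        rwa [h12, Bool.not_not, ← hb] at this
      have e2 : s₂ = (!s₁.1, s₂.2) := by rw [← h12]
      rw [e2] at halt hirr
      obtain ⟨L', hL'⟩ := exists_redRule_of_dvd pre L' halt hd1 hd2
      exact hirr _ L' (siv_ne_one hsq) hL'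
    · have h3 : (b₂.2 :: B.map Prod.snd).getLast (by simp) =
          ((b₂ :: B).getLast (by simp)).2 := List.getLast_map (f := Prod.snd) (l := b₂ :: B) _
      rw [h3, ← List.getLast_cons (a := b₁)]
      exact hclosed.symm

theorem semiConvergent_intervalMonoid (hinf : CondInf P) (hsup : CondSup P)
    (hP : ClosedZigzagsReducible P) {h : P → ℕ} (hh : StrictMono h) :
    SemiConvergent (IntervalMonoid P) := by
  obtain ⟨len, hlen⟩ := exists_isLength hh
  refine semiConvergent_of_exists_red hlen fun a ha ht => ?_
  obtain ⟨x, L', hx, hL'⟩ := exists_redRule_of_signedProd_eq_one hinf hsup hP a.alternating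
    (ha.signedProd_eq_one (toFree P)) (by rw [Multifraction.Trivial] at ht; push Not at ht; exact ht)
  exact a.exists_red hx hL'

end Zigzags

end MFR

/-! ### Zigzags, meets and joins in a strip. -/

namespace MFR

/-- The vertices of a strip between the positions `lo` and `hi`: on the levels `0`, `1`, `2`, with
the outermost positions on the levels `0` and `2` being odd, respectively even. -/
def StripVertex (lo hi l c : ℤ) : Prop :=
  l = 0 ∧ (c % 2 = 1 ∧ lo ≤ c ∧ c ≤ hi ∨ c % 2 = 0 ∧ lo < c ∧ c < hi) ∨
  l = 1 ∧ lo ≤ c ∧ c ≤ hi ∨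
  l = 2 ∧ (c % 2 = 0 ∧ lo ≤ c ∧ c ≤ hi ∨ c % 2 = 1 ∧ lo < c ∧ c < hi)

/-- The strict order on the vertices of a strip. -/
def StripLt (l c l' c' : ℤ) : Prop :=
  l = 0 ∧ l' = 1 ∧ c' - 1 ≤ c ∧ c ≤ c' + 1 ∧ (c ≠ c' ∨ c % 2 = 1) ∨
  l = 1 ∧ l' = 2 ∧ c' - 1 ≤ c ∧ c ≤ c' + 1 ∧ (c ≠ c' ∨ c % 2 = 0) ∨
  l = 0 ∧ l' = 2 ∧ c' - 2 ≤ c ∧ c ≤ c' + 2 ∧ (c % 2 = 1 ∨ c' % 2 = 0)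

theorem stripVertex_zero {lo hi c : ℤ} : StripVertex lo hi 0 c ↔
    c % 2 = 1 ∧ lo ≤ c ∧ c ≤ hi ∨ c % 2 = 0 ∧ lo < c ∧ c < hi := by
  simp [StripVertex]

theorem stripVertex_one {lo hi c : ℤ} : StripVertex lo hi 1 c ↔ lo ≤ c ∧ c ≤ hi := by
  simp [StripVertex]

theorem stripVertex_two {lo hi c : ℤ} : StripVertex lo hi 2 c ↔
    c % 2 = 0 ∧ lo ≤ c ∧ c ≤ hi ∨ c % 2 = 1 ∧ lo < c ∧ c < hi := by
  simp [StripVertex]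

theorem stripLt_zero_one {c c' : ℤ} : StripLt 0 c 1 c' ↔
    c' - 1 ≤ c ∧ c ≤ c' + 1 ∧ (c ≠ c' ∨ c % 2 = 1) := by
  simp [StripLt]

theorem stripLt_one_two {c c' : ℤ} : StripLt 1 c 2 c' ↔
    c' - 1 ≤ c ∧ c ≤ c' + 1 ∧ (c ≠ c' ∨ c % 2 = 0) := by
  simp [StripLt]

theorem stripLt_zero_two {c c' : ℤ} : StripLt 0 c 2 c' ↔
    c' - 2 ≤ c ∧ c ≤ c' + 2 ∧ (c % 2 = 1 ∨ c' % 2 = 0) := by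
  simp [StripLt]

theorem strip_exists_between {lo hi a b : ℤ} (va : StripVertex lo hi 0 a)
    (vb : StripVertex lo hi 2 b) (h : StripLt 0 a 2 b) :
    ∃ c, StripVertex lo hi 1 c ∧ StripLt 0 a 1 c ∧ StripLt 1 c 2 b := by
  simp only [stripVertex_zero, stripVertex_one, stripVertex_two, stripLt_zero_one,
    stripLt_one_two, stripLt_zero_two] at *
  rcases lt_trichotomy a b with h' | h' | h'
  · exact ⟨a + 1, by omega⟩
  · exact ⟨a + 1, by omega⟩
  · exact ⟨a - 1, by omega⟩

theorem strip_exists_common_lower {lo hi a b d : ℤ} (va : StripVertex lo hi 1 a)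
    (vb : StripVertex lo hi 1 b) (had : StripLt 1 a 2 d) (hbd : StripLt 1 b 2 d) (hab : a < b) :
    ∃ c, StripVertex lo hi 0 c ∧ StripLt 0 c 1 a ∧ StripLt 0 c 1 b := by
  simp only [stripVertex_zero, stripVertex_one, stripLt_zero_one, stripLt_one_two] at *
  rcases Int.emod_two_eq_zero_or_one a with h | h
  · exact ⟨a + 1, by omega⟩
  · by_cases h' : b = a + 1
    · exact ⟨a, by omega⟩
    · exact ⟨a + 1, by omega⟩

theorem strip_pos_of_not_exists {lo hi a b c : ℤ} (va : StripVertex lo hi 0 a)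
    (vb : StripVertex lo hi 0 b) (hac : StripLt 0 a 2 c) (hbc : StripLt 0 b 2 c)
    (h : ¬ ∃ m, StripVertex lo hi 1 m ∧ StripLt 0 a 1 m ∧ StripLt 0 b 1 m ∧ StripLt 1 m 2 c)
    (hab : a < b) : a < c ∧ c < b ∧ a + 3 ≤ b := by
  simp only [stripVertex_zero, stripVertex_one, stripLt_zero_one,
    stripLt_one_two, stripLt_zero_two] at *
  -- Both `a` and `b` are within distance two of `c`, so a gap of three forces `c` strictly between
  -- them. For a smaller gap, `a` or `a + 1`, chosen by parity, is the position of a forbidden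
  -- middle vertex.
  suffices a + 3 ≤ b by omega
  by_contra hlt
  apply h
  rcases Int.emod_two_eq_zero_or_one a with h' | h'
  · exact ⟨a + 1, by omega⟩
  · by_cases h'' : b = a + 1
    · exact ⟨a, by omega⟩
    · exact ⟨a + 1, by omega⟩

theorem strip_eq_of_not_exists {lo hi a b e t : ℤ} (va : StripVertex lo hi 2 a)
    (vb : StripVertex lo hi 2 b) (hea : StripLt 0 e 2 a) (heb : StripLt 0 e 2 b)
    (hta : StripLt 0 t 2 a) (htb : StripLt 0 t 2 b)
    (h : ¬ ∃ m, StripVertex lo hi 1 m ∧ StripLt 1 m 2 a ∧ StripLt 1 m 2 b)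
    (hab : a < b) : e = t := by
  simp only [stripVertex_one, stripVertex_two, stripLt_one_two, stripLt_zero_two] at *
  -- A common lower bound at the bottom lies between `b - 2` and `a + 2`. For `b = a + 4` this
  -- leaves one position; for `b = a + 3` it leaves two, and one of `a`, `b` is odd, so only the odd
  -- position qualifies.
  suffices a + 3 ≤ b by omega
  by_contra hlt
  apply h
  rcases Int.emod_two_eq_zero_or_one a with h' | h'
  · by_cases h'' : b = a + 1
    · exact ⟨a, by omega⟩
    · exact ⟨a + 1, by omega⟩
  · exact ⟨a + 1, by omega⟩

/-- Coordinates that identify a poset (`σ = true`) or its opposite (`σ = false`) with a strip. -/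
structure Strip (P : Type*) [PartialOrder P] (σ : Bool) where
  lo : ℤ
  hi : ℤ
  lv : P → ℤ
  pos : P → ℤ
  vertex : ∀ a, StripVertex lo hi (lv a) (pos a)
  exists_vertex : ∀ l c, StripVertex lo hi l c → ∃ a, lv a = l ∧ pos a = c
  inj : ∀ a b, lv a = lv b → pos a = pos b → a = b
  lt_iff : ∀ a b, SLt σ a b ↔ StripLt (lv a) (pos a) (lv b) (pos b)

namespace Strip

variable {P : Type*} [PartialOrder P] {σ : Bool}

theorem slt_not {a b : P} : SLt (!σ) a b ↔ SLt σ b a := by cases σ <;> rfl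

theorem sle_iff {a b : P} : SLe σ a b ↔ a = b ∨ SLt σ a b := by
  cases σ
  · exact le_iff_eq_or_lt.trans (or_congr_left eq_comm)
  · exact le_iff_eq_or_lt

/-- The opposite strip. -/
def opp (S : Strip P σ) : Strip P (!σ) where
  -- The shift by one exchanges the parities, as exchanging bottom and top requires.
  lo := S.lo + 1
  hi := S.hi + 1
  lv a := 2 - S.lv a
  pos a := S.pos a + 1
  vertex a := by
    rcases S.vertex a with h | h | h
    · exact .inr (.inr (by omega))
    · exact .inr (.inl (by omega))
    · exact .inl (by omega)
  exists_vertex l c h := by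
    obtain ⟨a, h1, h2⟩ := S.exists_vertex (2 - l) (c - 1) (by
      rcases h with h | h | h
      · exact .inr (.inr (by omega))
      · exact .inr (.inl (by omega))
      · exact .inl (by omega))
    exact ⟨a, by omega, by omega⟩
  inj a b h1 h2 := S.inj a b (by omega) (by omega)
  lt_iff a b := by
    rw [slt_not, S.lt_iff]
    constructor
    · rintro (h | h | h)
      · exact .inr (.inl (by omega))
      · exact .inl (by omega)
      · exact .inr (.inr (by omega))
    · rintro (h | h | h)
      · exact .inr (.inl (by omega))
      · exact .inl (by omega)
      · exact .inr (.inr (by omega))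

/-- The mirror image of a strip. -/
def mirror (S : Strip P σ) : Strip P σ where
  lo := -S.hi
  hi := -S.lo
  lv := S.lv
  pos a := -S.pos a
  vertex a := by
    rcases S.vertex a with h | h | h
    · exact .inl (by omega)
    · exact .inr (.inl (by omega))
    · exact .inr (.inr (by omega))
  exists_vertex l c h := by
    obtain ⟨a, h1, h2⟩ := S.exists_vertex l (-c) (by
      rcases h with h | h | h
      · exact .inl (by omega)
      · exact .inr (.inl (by omega))
      · exact .inr (.inr (by omega)))
    exact ⟨a, by omega, by omega⟩
  inj a b h1 h2 := S.inj a b (by omega) (by omega)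
  lt_iff a b := by
    rw [S.lt_iff]
    constructor
    · rintro (h | h | h)
      · exact .inl (by omega)
      · exact .inr (.inl (by omega))
      · exact .inr (.inr (by omega))
    · rintro (h | h | h)
      · exact .inl (by omega)
      · exact .inr (.inl (by omega))
      · exact .inr (.inr (by omega))

theorem slt_iff_of_lv (S : Strip P σ) {a b : P} {l l' : ℤ} (ha : S.lv a = l) (hb : S.lv b = l') :
    SLt σ a b ↔ StripLt l (S.pos a) l' (S.pos b) := by
  rw [S.lt_iff, ha, hb]

theorem lv_cases (S : Strip P σ) (a : P) : S.lv a = 0 ∨ S.lv a = 1 ∨ S.lv a = 2 := by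
  rcases S.vertex a with h | h | h
  · exact .inl h.1
  · exact .inr (.inl h.1)
  · exact .inr (.inr h.1)

theorem exists_of_lv (S : Strip P σ) {Q : P → Prop} (l : ℤ) (R : ℤ → Prop)
    (hR : ∀ a, S.lv a = l → R (S.pos a) → Q a)
    (h : ∃ c, StripVertex S.lo S.hi l c ∧ R c) : ∃ a, S.lv a = l ∧ Q a := by
  obtain ⟨c, hc, hRc⟩ := h
  obtain ⟨a, h1, rfl⟩ := S.exists_vertex l c hc
  exact ⟨a, h1, hR a h1 hRc⟩

theorem lv_lt (S : Strip P σ) {a b : P} (h : SLt σ a b) :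
    S.lv a = 0 ∧ S.lv b = 1 ∨ S.lv a = 1 ∧ S.lv b = 2 ∨ S.lv a = 0 ∧ S.lv b = 2 := by
  rcases (S.lt_iff a b).1 h with h | h | h
  · exact .inl ⟨h.1, h.2.1⟩
  · exact .inr (.inl ⟨h.1, h.2.1⟩)
  · exact .inr (.inr ⟨h.1, h.2.1⟩)

theorem exists_between (S : Strip P σ) {a b : P} (h : SLt σ a b) (ha : S.lv a = 0)
    (hb : S.lv b = 2) : ∃ d, S.lv d = 1 ∧ SLt σ a d ∧ SLt σ d b := by
  refine S.exists_of_lv 1 (fun c => StripLt 0 (S.pos a) 1 c ∧ StripLt 1 c 2 (S.pos b))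
    (fun d hd h => ⟨(S.slt_iff_of_lv ha hd).2 h.1, (S.slt_iff_of_lv hd hb).2 h.2⟩) ?_
  rw [S.slt_iff_of_lv ha hb] at h
  exact strip_exists_between (ha ▸ S.vertex a) (hb ▸ S.vertex b) h

theorem exists_common_lower (S : Strip P σ) {a b d : P} (had : SLt σ a d) (hbd : SLt σ b d)
    (ha : S.lv a = 1) (hb : S.lv b = 1) : ∃ t, SLe σ t a ∧ SLe σ t b := by
  have hd : S.lv d = 2 := by have := S.lv_lt had; omega
  by_cases hab : a = b
  · subst hab
    exact ⟨a, sle_iff.2 (.inl rfl), sle_iff.2 (.inl rfl)⟩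
  suffices ∃ t, S.lv t = 0 ∧ (SLe σ t a ∧ SLe σ t b) from this.imp fun _ h => h.2
  refine S.exists_of_lv 0 (fun c => StripLt 0 c 1 (S.pos a) ∧ StripLt 0 c 1 (S.pos b))
    (fun t ht h => ⟨sle_iff.2 (.inr ((S.slt_iff_of_lv ht ha).2 h.1)),
      sle_iff.2 (.inr ((S.slt_iff_of_lv ht hb).2 h.2))⟩) ?_
  rw [S.slt_iff_of_lv ha hd] at had
  rw [S.slt_iff_of_lv hb hd] at hbd
  have va := ha ▸ S.vertex a
  have vb := hb ▸ S.vertex b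
  rcases lt_trichotomy (S.pos a) (S.pos b) with h | h | h
  · exact strip_exists_common_lower va vb had hbd h
  · exact absurd (S.inj a b (ha.trans hb.symm) h) hab
  · obtain ⟨c, h1, h2, h3⟩ := strip_exists_common_lower vb va hbd had h
    exact ⟨c, h1, h3, h2⟩

/-- A turn coming from the middle level is reducible. -/
theorem turnRed_of_lv_one (S : Strip P σ) {p q r : P} (hpq : SLt σ p q) (hrq : SLt σ r q)
    (hp : S.lv p = 1) : TurnRed σ p q r := by
  have hq : S.lv q = 2 := by have := S.lv_lt hpq; omega
  rcases S.lv_lt hrq with h | h | h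
  · omega
  · obtain ⟨t, h1, h2⟩ := S.exists_common_lower hpq hrq hp h.1
    exact ⟨r, t, sle_iff.2 (.inl rfl), hrq, h1, h2⟩
  · obtain ⟨s, hs, hrs, hsq⟩ := S.exists_between hrq h.1 h.2
    obtain ⟨t, h1, h2⟩ := S.exists_common_lower hpq hsq hp hs
    exact ⟨s, t, sle_iff.2 (.inr hrs), hsq, h1, h2⟩

theorem turnRed_of_between {p q r s : P} (hrs : SLe σ r s) (hsq : SLt σ s q) (hps : SLe σ p s) :
    TurnRed σ p q r := ⟨s, p, hrs, hsq, sle_iff.2 (.inl rfl), hps⟩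

/-- Irreducible turns between bottom and top vertices keep their direction. -/
theorem pos_of_lv_zero (S : Strip P σ) {p q r : P} (hpq : SLt σ p q) (hrq : SLt σ r q)
    (h : ¬ TurnRed σ p q r) (hp : S.lv p = 0) (hq : S.lv q = 2) (hr : S.lv r = 0) :
    S.pos p < S.pos q ∧ S.pos q < S.pos r ∧ S.pos p + 3 ≤ S.pos r ∨
    S.pos r < S.pos q ∧ S.pos q < S.pos p ∧ S.pos r + 3 ≤ S.pos p := by
  have hne : S.pos p ≠ S.pos r := fun h' => by
    have := S.inj p r (hp.trans hr.symm) h'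
    subst this
    exact h (turnRed_of_between (sle_iff.2 (.inl rfl)) hpq (sle_iff.2 (.inl rfl)))
  have key : ∀ m, StripVertex S.lo S.hi 1 m → StripLt 0 (S.pos p) 1 m →
      StripLt 0 (S.pos r) 1 m → StripLt 1 m 2 (S.pos q) → False := by
    intro m hm h1 h2 h3
    obtain ⟨s, hs, rfl⟩ := S.exists_vertex 1 m hm
    exact h (turnRed_of_between (sle_iff.2 (.inr ((S.slt_iff_of_lv hr hs).2 h2)))
      ((S.slt_iff_of_lv hs hq).2 h3) (sle_iff.2 (.inr ((S.slt_iff_of_lv hp hs).2 h1))))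
  have vp := hp ▸ S.vertex p
  have vr := hr ▸ S.vertex r
  rw [S.slt_iff_of_lv hp hq] at hpq
  rw [S.slt_iff_of_lv hr hq] at hrq
  rcases lt_or_gt_of_ne hne with h' | h'
  · exact .inl (strip_pos_of_not_exists vp vr hpq hrq
      (fun ⟨m, h0, h1, h2, h3⟩ => key m h0 h1 h2 h3) h')
  · exact .inr (strip_pos_of_not_exists vr vp hrq hpq
      (fun ⟨m, h0, h1, h2, h3⟩ => key m h0 h2 h1 h3) h')

theorem not_slt_of_not_turnRed {p q r : P} (hrq : SLt σ r q) (h : ¬ TurnRed σ p q r) :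
    ¬ SLt σ p r := fun h' =>
  h (turnRed_of_between (sle_iff.2 (.inl rfl)) hrq (sle_iff.2 (.inr h')))

/-- Irreducible turns from the bottom over the top to the middle. -/
theorem pos_of_lv_one (S : Strip P σ) {p q r : P} (hpq : SLt σ p q) (hrq : SLt σ r q)
    (h : ¬ TurnRed σ p q r) (hp : S.lv p = 0) (hq : S.lv q = 2) (hr : S.lv r = 1)
    (hlt : S.pos p < S.pos q) :
    S.pos q ≤ S.pos r ∧ (S.pos q = S.pos r → S.pos q = S.pos p + 2) := by
  have hn := not_slt_of_not_turnRed hrq h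
  rw [S.slt_iff_of_lv hp hr] at hn
  rw [S.slt_iff_of_lv hp hq] at hpq
  rw [S.slt_iff_of_lv hr hq] at hrq
  simp only [stripLt_zero_one, stripLt_one_two, stripLt_zero_two] at hn hpq hrq
  omega

/-- A bottom vertex and a middle vertex that are not comparable have at most one common top
vertex above them. -/
theorem eq_of_common_upper (S : Strip P σ) {a b d e : P} (ha : S.lv a = 0) (hb : S.lv b = 1)
    (hab : ¬ SLt σ a b) (had : SLt σ a d) (hbd : SLt σ b d) (hae : SLt σ a e)
    (hbe : SLt σ b e) : d = e := by
  have hd : S.lv d = 2 := by have := S.lv_lt hbd; omega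
  have he : S.lv e = 2 := by have := S.lv_lt hbe; omega
  refine S.inj d e (hd.trans he.symm) ?_
  rw [S.slt_iff_of_lv ha hb] at hab
  rw [S.slt_iff_of_lv ha hd] at had
  rw [S.slt_iff_of_lv hb hd] at hbd
  rw [S.slt_iff_of_lv ha he] at hae
  rw [S.slt_iff_of_lv hb he] at hbe
  simp only [stripLt_zero_one, stripLt_one_two, stripLt_zero_two] at hab had hbd hae hbe
  omega

theorem opp_lv (S : Strip P σ) (a : P) : S.opp.lv a = 2 - S.lv a := rfl

theorem opp_pos (S : Strip P σ) (a : P) : S.opp.pos a = S.pos a + 1 := rfl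

/-- The end of an irreducible zigzag that starts rightwards is not to the left of its second
vertex, with one exception. -/
theorem pos_getLast (S : Strip P σ) {p q r : P} {l : List P} (hpq : SLt σ p q)
    (hp : S.lv p = 0) (hq : S.lv q = 2) (hlt : S.pos p < S.pos q)
    (h : IrredZigzag σ p q (r :: l)) :
    S.pos q ≤ S.pos ((r :: l).getLast (by simp)) ∨
    S.pos q - 1 = S.pos ((r :: l).getLast (by simp)) ∧
      S.lv ((r :: l).getLast (by simp)) = 2 ∧ S.pos q = S.pos p + 2 := by
  induction l generalizing σ p q r with
  | nil =>
    obtain ⟨hqr, hred, -⟩ := h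
    rw [slt_not] at hqr
    rw [List.getLast_singleton]
    rcases S.lv_lt hqr with h' | h' | h'
    · omega
    · have := S.pos_of_lv_one hpq hqr hred hp hq h'.1 hlt
      omega
    · have := S.pos_of_lv_zero hpq hqr hred hp hq h'.1
      omega
  | cons s l ih =>
    obtain ⟨hqr, hred, h⟩ := h
    have hqr' := slt_not.1 hqr
    rw [List.getLast_cons (by simp)]
    rcases S.lv_lt hqr' with h' | h' | h'
    · omega
    -- A turn starting at the middle vertex `r` would be reducible, so at most one more vertex
    -- follows `r`. This is where the exceptional end point can occur.
    · have h1 := S.pos_of_lv_one hpq hqr' hred hp hq h'.1 hlt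
      obtain ⟨hrs, -, h⟩ := h
      rw [Bool.not_not] at hrs
      cases l with
      | nil =>
        rw [List.getLast_singleton]
        have hs : S.lv s = 2 := by have := S.lv_lt hrs; omega
        have hrs' := (S.slt_iff_of_lv h'.1 hs).1 hrs
        simp only [stripLt_one_two] at hrs'
        omega
      | cons s' l =>
        obtain ⟨hss, hred, -⟩ := h
        rw [Bool.not_not] at hss hred
        exact absurd (S.turnRed_of_lv_one hrs (slt_not.1 hss) h'.1) hred
    -- The zigzag goes on rightwards from `q` at the top to `r` at the bottom, which is the initial
    -- situation in the opposite strip.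
    · have h1 := S.pos_of_lv_zero hpq hqr' hred hp hq h'.1
      have h2 := ih S.opp hqr (by rw [opp_lv]; omega) (by rw [opp_lv]; omega)
        (by rw [opp_pos, opp_pos]; omega) h
      simp only [opp_pos, opp_lv] at h2
      omega

/-- The vertex `p` is above `q` and at most two positions away, hence to the left of `s`. The zigzag
ends at or to the right of `s`, or else one position to its left on the bottom level, where `p`
cannot be. -/
theorem getLast_ne_of_pos_lt (S : Strip P σ) {p q r s s' : P} {l : List P} (hqp : SLt σ q p)
    (hq : S.lv q = 0) (hr : S.lv r = 2) (hs : S.lv s = 0) (hrs' : S.pos r < S.pos s) (hqs : S.pos q + 3 ≤ S.pos s)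
    (h : IrredZigzag σ q r (s :: s' :: l)) : (s' :: l).getLast (by simp) ≠ p := by
  intro heq
  obtain ⟨hrs, -, h⟩ := h
  have h2 := S.opp.pos_getLast hrs (by rw [opp_lv]; omega) (by rw [opp_lv]; omega)
    (by rw [opp_pos, opp_pos]; omega) h
  rw [heq] at h2
  simp only [opp_pos, opp_lv] at h2
  have h3 := (S.lt_iff q p).1 hqp
  unfold StripLt at h3
  omega

/-- Two irreducible turns force `q` to the bottom and `r` to the top. If `s` is at the bottom, the
zigzag runs away from `q` in one direction, rightwards up to reflection. If `s` is in the middle, it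
ends at `s'`, and closing up would make `r` and `s'` two upper bounds of the incomparable `q` and
`s`, hence equal. -/
theorem getLast_ne (S : Strip P σ) {p q r s s' : P} {l : List P} (hqp : SLt σ q p)
    (hqr : SLt σ q r) (h : IrredZigzag σ q r (s :: s' :: l)) :
    (s' :: l).getLast (by simp) ≠ p := by
  have h' := h
  obtain ⟨hrs, hred, hss, hred', h''⟩ := h
  rw [slt_not] at hrs
  rw [Bool.not_not] at hss
  have hr : S.lv r = 2 := by
    by_contra hr
    exact hred' (S.opp.turnRed_of_lv_one (slt_not.2 hrs) (slt_not.2 hss) (by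
      have := S.lv_lt hrs
      have := S.lv_lt hqr
      rw [opp_lv]
      omega))
  have hq : S.lv q = 0 := by
    by_contra hq
    exact hred (S.turnRed_of_lv_one hqr hrs (by have := S.lv_lt hqr; omega))
  rcases S.lv_cases s with hs | hs | hs
  · rcases S.pos_of_lv_zero hqr hrs hred hq hr hs with ⟨h1, h2, h3⟩ | ⟨h1, h2, h3⟩
    · exact S.getLast_ne_of_pos_lt hqp hq hr hs h2 h3 h'
    · have e : ∀ a, S.mirror.pos a = -S.pos a := fun a => rfl
      exact S.mirror.getLast_ne_of_pos_lt hqp hq hr hs (by rw [e, e]; omega)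
        (by rw [e, e]; omega) h'
  · cases l with
    | nil =>
      rintro rfl
      rw [List.getLast_singleton] at hqp
      have := S.eq_of_common_upper hq hs (not_slt_of_not_turnRed hrs hred) hqr hrs hqp hss
      subst this
      exact hred' ⟨r, r, sle_iff.2 (.inl rfl), slt_not.2 hrs, sle_iff.2 (.inl rfl),
        sle_iff.2 (.inl rfl)⟩
    | cons s'' l =>
      obtain ⟨hss', hred'', -⟩ := h''
      rw [Bool.not_not] at hred'' hss'
      exact absurd (S.turnRed_of_lv_one hss (slt_not.1 hss') hs) hred''
  · have := S.lv_lt hrs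
    omega

end Strip

theorem closedZigzagsReducible_of_strip {P : Type*} [PartialOrder P] (S : Strip P true) :
    ClosedZigzagsReducible P := by
  intro σ p q r l hpq hqr hov h heq
  have S' : Strip P (!σ) := by
    cases σ
    · exact S
    · exact S.opp
  -- Closed zigzags with two or three steps are excluded by the overlap at the first turn; longer
  -- ones by the geometry of the strip.
  match l with
  | [] =>
    rw [List.getLast_singleton] at heq
    subst heq
    exact hov ⟨r, Strip.sle_iff.2 (.inl rfl), hpq, Strip.sle_iff.2 (.inl rfl)⟩
  | [s] =>
    obtain ⟨hrs, -⟩ := h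
    rw [Bool.not_not] at hrs
    have hs : s = p := heq
    subst hs
    exact hov ⟨s, Strip.sle_iff.2 (.inr hrs), hpq, Strip.sle_iff.2 (.inl rfl)⟩
  | s :: s' :: l =>
    exact S'.getLast_ne (Strip.slt_not.2 hpq) hqr h heq

/-- Two vertices of a strip with a common lower bound have a greatest lower bound. -/
theorem Strip.exists_glb {P : Type*} [PartialOrder P] {σ : Bool} (S : Strip P σ) {a b t : P}
    (hta : SLe σ t a) (htb : SLe σ t b) :
    ∃ d, SLe σ d a ∧ SLe σ d b ∧ ∀ e, SLe σ e a → SLe σ e b → SLe σ e d := by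
  have refl : ∀ a : P, SLe σ a a := fun a => sle_iff.2 (.inl rfl)
  by_cases hab : SLe σ a b
  · exact ⟨a, refl a, hab, fun e h _ => h⟩
  by_cases hba : SLe σ b a
  · exact ⟨b, hba, refl b, fun e _ h => h⟩
  have hlt : ∀ e, SLe σ e a → SLe σ e b → SLt σ e a ∧ SLt σ e b := by
    intro e h1 h2
    rcases sle_iff.1 h1 with rfl | h1'
    · exact absurd h2 hab
    · rcases sle_iff.1 h2 with rfl | h2'
      · exact absurd h1 hba
      · exact ⟨h1', h2'⟩
  -- For incomparable `a` and `b`, a common lower bound on the middle level is the meet. If there is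
  -- none, `t` is the only common lower bound.
  by_cases hmid : ∃ d, S.lv d = 1 ∧ SLt σ d a ∧ SLt σ d b
  · obtain ⟨d, hd, hda, hdb⟩ := hmid
    have ha : S.lv a = 2 := by have := S.lv_lt hda; omega
    have hb : S.lv b = 2 := by have := S.lv_lt hdb; omega
    refine ⟨d, sle_iff.2 (.inr hda), sle_iff.2 (.inr hdb), fun e hea heb => ?_⟩
    obtain ⟨hea, heb⟩ := hlt e hea heb
    have hne : S.pos a ≠ S.pos b := fun h =>
      hab (sle_iff.2 (.inl (S.inj a b (ha.trans hb.symm) h)))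
    rw [S.slt_iff_of_lv hd ha, stripLt_one_two] at hda
    rw [S.slt_iff_of_lv hd hb, stripLt_one_two] at hdb
    rcases S.lv_lt hea with h | h | h
    · omega
    · rw [S.slt_iff_of_lv h.1 ha, stripLt_one_two] at hea
      rw [S.slt_iff_of_lv h.1 hb, stripLt_one_two] at heb
      exact sle_iff.2 (.inl (S.inj e d (h.1.trans hd.symm) (by omega)))
    · rw [S.slt_iff_of_lv h.1 ha, stripLt_zero_two] at hea
      rw [S.slt_iff_of_lv h.1 hb, stripLt_zero_two] at heb
      exact sle_iff.2 (.inr ((S.slt_iff_of_lv h.1 hd).2 (stripLt_zero_one.2 (by omega))))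
  · refine ⟨t, hta, htb, fun e hea heb => ?_⟩
    obtain ⟨hta, htb⟩ := hlt t hta htb
    obtain ⟨hea, heb⟩ := hlt e hea heb
    have ht : S.lv t = 0 := by
      by_contra h
      exact hmid ⟨t, by have := S.lv_lt hta; omega, hta, htb⟩
    have he : S.lv e = 0 := by
      by_contra h
      exact hmid ⟨e, by have := S.lv_lt hea; omega, hea, heb⟩
    refine sle_iff.2 (.inl (S.inj e t (he.trans ht.symm) ?_))
    have hne : S.lv a = S.lv b → S.pos a ≠ S.pos b := fun h h' =>
      hab (sle_iff.2 (.inl (S.inj a b h h')))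
    have ha : S.lv a = 1 ∨ S.lv a = 2 := by have := S.lv_lt hta; omega
    have hb : S.lv b = 1 ∨ S.lv b = 2 := by have := S.lv_lt htb; omega
    have hopp : ∀ a b : P, S.lv a = 1 → S.lv b = 2 → ¬ SLe σ a b → SLt σ t a → SLt σ t b →
        SLt σ e a → SLt σ e b → e = t := fun a b ha hb hab hta htb hea heb =>
      S.opp.eq_of_common_upper (a := b) (b := a) (by rw [opp_lv]; omega) (by rw [opp_lv]; omega)
        (fun h => hab (sle_iff.2 (.inr (slt_not.1 h)))) (slt_not.2 heb) (slt_not.2 hea)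
        (slt_not.2 htb) (slt_not.2 hta)
    rcases ha with ha | ha <;> rcases hb with hb | hb
    · rw [S.slt_iff_of_lv ht ha, stripLt_zero_one] at hta
      rw [S.slt_iff_of_lv ht hb, stripLt_zero_one] at htb
      rw [S.slt_iff_of_lv he ha, stripLt_zero_one] at hea
      rw [S.slt_iff_of_lv he hb, stripLt_zero_one] at heb
      have := hne (ha.trans hb.symm)
      omega
    · rw [hopp a b ha hb hab hta htb hea heb]
    · rw [hopp b a hb ha hba htb hta heb hea]
    · have hmid' : ∀ m, StripVertex S.lo S.hi 1 m → StripLt 1 m 2 (S.pos a) →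
          StripLt 1 m 2 (S.pos b) → False := by
        intro m hm h1 h2
        obtain ⟨d, hd, rfl⟩ := S.exists_vertex 1 m hm
        exact hmid ⟨d, hd, (S.slt_iff_of_lv hd ha).2 h1, (S.slt_iff_of_lv hd hb).2 h2⟩
      rw [S.slt_iff_of_lv ht ha] at hta
      rw [S.slt_iff_of_lv ht hb] at htb
      rw [S.slt_iff_of_lv he ha] at hea
      rw [S.slt_iff_of_lv he hb] at heb
      rcases lt_or_gt_of_ne (hne (ha.trans hb.symm)) with h | h
      · exact strip_eq_of_not_exists (ha ▸ S.vertex a) (hb ▸ S.vertex b) hea heb hta htb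
          (fun ⟨m, h0, h1, h2⟩ => hmid' m h0 h1 h2) h
      · exact strip_eq_of_not_exists (hb ▸ S.vertex b) (ha ▸ S.vertex a) heb hea htb hta
          (fun ⟨m, h0, h1, h2⟩ => hmid' m h0 h2 h1) h

theorem condInf_of_strip {P : Type*} [PartialOrder P] (S : Strip P true) : CondInf P := by
  intro a b c hca hcb
  obtain ⟨d, h1, h2, h3⟩ := S.exists_glb hca hcb
  exact ⟨d, by simpa using ⟨h1, h2⟩, fun e he => h3 e (he (by simp)) (he (by simp))⟩

theorem condSup_of_strip {P : Type*} [PartialOrder P] (S : Strip P true) : CondSup P := by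
  intro a b c hca hcb
  obtain ⟨d, h1, h2, h3⟩ := S.opp.exists_glb hca hcb
  exact ⟨d, by simpa using ⟨h1, h2⟩, fun e he => h3 e (he (by simp)) (he (by simp))⟩

theorem strictMono_of_strip {P : Type*} [PartialOrder P] (S : Strip P true) :
    StrictMono fun a => (S.lv a).toNat := by
  intro a b hab
  have := S.lv_lt (σ := true) hab
  change (S.lv a).toNat < (S.lv b).toNat
  omega

end MFR

/-! ### Coordinates on `P_{A,n}`, its cardinality and the long zigzag. -/

namespace MFR

namespace PA

variable {n : ℕ}

/-- The level of a vertex. -/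
def lv : PA n → ℤ
  | x _ => 0
  | y _ => 1
  | z _ => 2

/-- The horizontal position of a vertex. -/
def pos : PA n → ℤ
  | x i => (i : ℕ)
  | y j => (j : ℕ)
  -- With this shift every edge joins positions at distance at most one.
  | z k => (k : ℕ) - 1

theorem edge_iff (a b : PA n) : Edge a b ↔
    lv a = 0 ∧ lv b = 1 ∧ pos b - 1 ≤ pos a ∧ pos a ≤ pos b + 1 ∧
      (pos a ≠ pos b ∨ pos a % 2 = 1) ∨
    lv a = 1 ∧ lv b = 2 ∧ pos b - 1 ≤ pos a ∧ pos a ≤ pos b + 1 ∧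
      (pos a ≠ pos b ∨ pos a % 2 = 0) := by
  constructor
  · rintro (⟨i, j, h⟩ | ⟨j, k, h⟩)
    · refine .inl ⟨rfl, rfl, ?_⟩
      simp only [pos, Nat.odd_iff] at h ⊢
      omega
    · refine .inr ⟨rfl, rfl, ?_⟩
      have := (Finset.mem_Icc.1 k.2).1
      simp only [pos, Nat.odd_iff] at h ⊢
      omega
  · intro h
    cases a with
    | x i =>
      cases b with
      | y j =>
        refine .xy i j ?_
        simp only [lv, pos, Nat.odd_iff] at h ⊢
        omega
      | _ => simp [lv] at h
    | y j =>
      cases b with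
      | z k =>
        refine .yz j k ?_
        have := (Finset.mem_Icc.1 k.2).1
        simp only [lv, pos, Nat.odd_iff] at h ⊢
        omega
      | _ => simp [lv] at h
    | z k => simp [lv] at h

theorem lt_iff_edge (a b : PA n) : a < b ↔ Edge a b ∨ ∃ c, Edge a c ∧ Edge c b := by
  rw [lt_iff_le_and_ne]
  constructor
  · rintro ⟨rfl | h, hne⟩
    · exact absurd rfl hne
    · exact h
  · intro h
    refine ⟨.inr h, ?_⟩
    rintro rfl
    rcases h with h | ⟨c, h, h'⟩
    · cases h
    · cases h <;> cases h'

theorem stripVertex (a : PA n) : StripVertex 0 (n + 1) (lv a) (pos a) := by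
  cases a with
  | x i =>
    have := Finset.mem_Icc.1 i.2
    simp only [lv, pos, stripVertex_zero]
    omega
  | y j =>
    have := j.2
    simp only [lv, pos, stripVertex_one]
    omega
  | z k =>
    have := Finset.mem_Icc.1 k.2
    simp only [lv, pos, stripVertex_two]
    omega

theorem exists_vertex (l c : ℤ) (h : StripVertex 0 (n + 1) l c) :
    ∃ a : PA n, lv a = l ∧ pos a = c := by
  rcases h with ⟨rfl, h⟩ | ⟨rfl, h⟩ | ⟨rfl, h⟩
  · refine ⟨x ⟨c.toNat, Finset.mem_Icc.2 (by omega)⟩, rfl, ?_⟩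
    simp only [pos]
    omega
  · refine ⟨y ⟨c.toNat, by omega⟩, rfl, ?_⟩
    simp only [pos]
    omega
  · refine ⟨z ⟨(c + 1).toNat, Finset.mem_Icc.2 (by omega)⟩, rfl, ?_⟩
    simp only [pos]
    omega

theorem ext_of_pos (a b : PA n) (h : lv a = lv b) (h' : pos a = pos b) : a = b := by
  cases a <;> cases b <;> simp only [lv, pos] at h h' <;> first | omega | skip
  · congr 1; exact Subtype.ext (by omega)
  · congr 1; exact Fin.ext (by omega)
  · congr 1; exact Subtype.ext (by omega)

theorem lt_iff (a b : PA n) : a < b ↔ StripLt (lv a) (pos a) (lv b) (pos b) := by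
  rw [lt_iff_edge]
  constructor
  · rintro (h | ⟨c, h, h'⟩)
    · rcases (edge_iff a b).1 h with h | h
      · exact .inl h
      · exact .inr (.inl h)
    · rw [edge_iff] at h h'
      refine .inr (.inr ?_)
      omega
  · intro h
    rcases h with h | h | ⟨ha, hb, h⟩
    · exact .inl ((edge_iff a b).2 (.inl h))
    · exact .inl ((edge_iff a b).2 (.inr h))
    · right
      obtain ⟨c, h0, h1, h2⟩ := strip_exists_between (ha ▸ stripVertex a) (hb ▸ stripVertex b)
        (stripLt_zero_two.2 h)
      obtain ⟨d, hd, rfl⟩ := exists_vertex 1 c h0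
      rw [stripLt_zero_one] at h1
      rw [stripLt_one_two] at h2
      exact ⟨d, (edge_iff a d).2 (.inl ⟨ha, hd, h1⟩), (edge_iff d b).2 (.inr ⟨hd, hb, h2⟩)⟩

variable (n) in
/-- The poset `P_{A,n}` is a strip. -/
def strip : Strip (PA n) true where
  lo := 0
  hi := n + 1
  lv := lv
  pos := pos
  vertex := stripVertex
  exists_vertex := exists_vertex
  inj := ext_of_pos
  lt_iff := lt_iff

theorem nat_card (n : ℕ) : Nat.card (PA n) = 3 * n + 4 := by
  let e : PA n ≃ (Finset.Icc 1 (2 * (n / 2) + 1) ⊕ Fin (n + 2)) ⊕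
      Finset.Icc 1 (2 * ((n + 1) / 2) + 1) :=
    { toFun := fun a => match a with
        | x i => .inl (.inl i)
        | y j => .inl (.inr j)
        | z k => .inr k
      invFun := fun s => match s with
        | .inl (.inl i) => x i
        | .inl (.inr j) => y j
        | .inr k => z k
      left_inv := fun a => by cases a <;> rfl
      right_inv := fun s => by rcases s with (_ | _) | _ <;> rfl }
  rw [Nat.card_congr e, Nat.card_eq_fintype_card]
  simp only [Fintype.card_sum, Fintype.card_coe, Nat.card_Icc, Fintype.card_fin]
  omega

/-- The vertex with given coordinates. -/
noncomputable def vertex (l c : ℤ) (h : StripVertex 0 (n + 1) l c) : PA n :=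
  (exists_vertex l c h).choose

theorem lv_vertex (l c : ℤ) (h : StripVertex 0 ((n : ℤ) + 1) l c) : lv (vertex l c h) = l :=
  (exists_vertex l c h).choose_spec.1

theorem pos_vertex (l c : ℤ) (h : StripVertex 0 ((n : ℤ) + 1) l c) : pos (vertex l c h) = c :=
  (exists_vertex l c h).choose_spec.2

/-- The coordinates of the boundary zigzag. -/
def zigzagCoord (n : ℕ) (k : ℕ) : ℤ × ℤ :=
  -- From the top left corner, go right through even bottom and odd middle positions, turn at the
  -- right end, and return through odd top and even middle positions. The parities keep the two
  -- passages disjoint; the right end depends on the parity of `n`.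
  if k = 0 ∨ k = 2 * n + 2 then (2, 0)
  else if k + 1 = n ∧ k % 2 = 0 then (2, n + 1)
  else if k ≤ n then (if k % 2 = 1 ∧ k < n then (0, k + 1) else (1, k + 1))
  else if k = n + 1 ∧ n % 2 = 0 then (0, n + 1)
  else if k % 2 = 0 then (2, 2 * n + 1 - k) else (1, 2 * n + 1 - k)

theorem zigzagCoord_spec (n k : ℕ) : ∃ l c : ℤ, zigzagCoord n k = (l, c) ∧
    ((k = 0 ∨ k = 2 * n + 2) ∧ l = 2 ∧ c = 0 ∨
    k ≠ 0 ∧ k + 1 = n ∧ k % 2 = 0 ∧ l = 2 ∧ c = n + 1 ∨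
    k < n ∧ k % 2 = 1 ∧ l = 0 ∧ c = k + 1 ∨
    k ≠ 0 ∧ k ≤ n ∧ ¬ (k + 1 = n ∧ k % 2 = 0) ∧ ¬ (k % 2 = 1 ∧ k < n) ∧ l = 1 ∧ c = k + 1 ∨
    k = n + 1 ∧ n % 2 = 0 ∧ l = 0 ∧ c = n + 1 ∨
    n < k ∧ k ≠ 2 * n + 2 ∧ k % 2 = 0 ∧ l = 2 ∧ c = 2 * n + 1 - k ∨
    n < k ∧ ¬ (k = n + 1 ∧ n % 2 = 0) ∧ k % 2 = 1 ∧ l = 1 ∧ c = 2 * n + 1 - k) := by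
  unfold zigzagCoord
  split_ifs
  · exact ⟨_, _, rfl, .inl (by omega)⟩
  · exact ⟨_, _, rfl, .inr (.inl (by omega))⟩
  · exact ⟨_, _, rfl, .inr (.inr (.inl (by omega)))⟩
  · exact ⟨_, _, rfl, .inr (.inr (.inr (.inl (by omega))))⟩
  · exact ⟨_, _, rfl, .inr (.inr (.inr (.inr (.inl (by omega)))))⟩
  · exact ⟨_, _, rfl, .inr (.inr (.inr (.inr (.inr (.inl (by omega))))))⟩
  · exact ⟨_, _, rfl, .inr (.inr (.inr (.inr (.inr (.inr (by omega))))))⟩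

theorem zigzagCoord_vertex (hn : 2 ≤ n) (k : ℕ) (hk : k ≤ 2 * n + 2) :
    StripVertex 0 (n + 1) (zigzagCoord n k).1 (zigzagCoord n k).2 := by
  obtain ⟨l, c, hlc, h⟩ := zigzagCoord_spec n k
  rw [hlc]
  rcases h with h | h | h | h | h | h | h <;>
  first
  | exact .inl (by omega)
  | exact .inr (.inl (by omega))
  | exact .inr (.inr (by omega))

theorem zigzagCoord_lt_of_odd (hn : 2 ≤ n) (k : ℕ) (hk : k < 2 * n + 2) (hodd : k % 2 = 1) :
    StripLt (zigzagCoord n k).1 (zigzagCoord n k).2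
      (zigzagCoord n (k + 1)).1 (zigzagCoord n (k + 1)).2 := by
  obtain ⟨l, c, hlc, h⟩ := zigzagCoord_spec n k
  obtain ⟨l', c', hlc', h'⟩ := zigzagCoord_spec n (k + 1)
  rw [hlc, hlc']
  rcases h with h | h | h | h | h | h | h <;>
  rcases h' with h' | h' | h' | h' | h' | h' | h' <;>
  first
  | omega
  | exact .inl (by omega)
  | exact .inr (.inl (by omega))
  | exact .inr (.inr (by omega))

theorem zigzagCoord_lt_of_even (hn : 2 ≤ n) (k : ℕ) (hk : k < 2 * n + 2) (heven : k % 2 = 0) :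
    StripLt (zigzagCoord n (k + 1)).1 (zigzagCoord n (k + 1)).2
      (zigzagCoord n k).1 (zigzagCoord n k).2 := by
  obtain ⟨l, c, hlc, h⟩ := zigzagCoord_spec n k
  obtain ⟨l', c', hlc', h'⟩ := zigzagCoord_spec n (k + 1)
  rw [hlc, hlc']
  rcases h with h | h | h | h | h | h | h <;>
  rcases h' with h' | h' | h' | h' | h' | h' | h' <;>
  first
  | omega
  | exact .inl (by omega)
  | exact .inr (.inl (by omega))
  | exact .inr (.inr (by omega))

theorem zigzagCoord_inj (hn : 2 ≤ n) (k m : ℕ) (hk : k < 2 * n + 2)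
    (h1 : (zigzagCoord n (k + 1)).1 = (zigzagCoord n (m + 1)).1)
    (h2 : (zigzagCoord n (k + 1)).2 = (zigzagCoord n (m + 1)).2) : k = m := by
  obtain ⟨l, c, hlc, h⟩ := zigzagCoord_spec n (k + 1)
  obtain ⟨l', c', hlc', h'⟩ := zigzagCoord_spec n (m + 1)
  rw [hlc, hlc'] at h1 h2
  rcases h with h | h | h | h | h | h | h <;>
  rcases h' with h' | h' | h' | h' | h' | h' | h' <;>
  omega

theorem exists_isSimpleClosedZigzag (hn : 2 ≤ n) :
    ∃ x : Fin ((2 * n + 2) + 1) → PA n, IsSimpleClosedZigzag x := by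
  have hv : ∀ k : Fin ((2 * n + 2) + 1), StripVertex 0 ((n : ℤ) + 1) (zigzagCoord n k).1
      (zigzagCoord n k).2 := fun k => zigzagCoord_vertex hn k (by omega)
  refine ⟨fun k => vertex _ _ (hv k), by omega, .inr fun i => ⟨fun h => ?_, fun h => ?_⟩, ?_, ?_⟩
  · rw [lt_iff, lv_vertex, lv_vertex, pos_vertex, pos_vertex]
    exact zigzagCoord_lt_of_odd hn i i.2 (Nat.odd_iff.1 h)
  · rw [lt_iff, lv_vertex, lv_vertex, pos_vertex, pos_vertex]
    exact zigzagCoord_lt_of_even hn i i.2 (Nat.even_iff.1 h)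
  · apply ext_of_pos
    · rw [lv_vertex, lv_vertex]; simp [zigzagCoord]
    · rw [pos_vertex, pos_vertex]; simp [zigzagCoord]
  · intro i j hij
    have h1 := congrArg lv hij
    have h2 := congrArg pos hij
    simp only [lv_vertex, pos_vertex] at h1 h2
    exact Fin.ext (zigzagCoord_inj hn i j i.2 h1 h2)

end PA

end MFR

/-! ### Failure of convergence. -/

namespace MFR

section NonConvergence

variable {P : Type*} [PartialOrder P]

theorem LeftDvd.eq_iv {p q : P} {e : IntervalMonoid P} (hpq : p < q) (h : LeftDvd e (iv p q))
    (he : e ≠ 1) : ∃ t, p < t ∧ t ≤ q ∧ e = iv p t := by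
  obtain ⟨m, hm, rfl⟩ := exists_nf e
  match m with
  | [] => exact absurd rfl he
  | (a, t) :: m =>
    rw [show iv p q = nfProd [(p, q)] by simp, leftDvd_cons_iff hm (isNF_singleton hpq)] at h
    obtain ⟨q', l', h1, h2⟩ := h
    simp only [List.cons.injEq, Prod.mk.injEq] at h1
    obtain ⟨⟨rfl, rfl⟩, rfl⟩ := h1
    rcases h2 with ⟨rfl, h2⟩ | ⟨hm0, -, x, hx⟩
    · exact ⟨t, hm.lt, h2, by simp⟩
    · exact absurd (hm.tail.inj IsNF.nil (eq_one_of_mul_eq_one hx)) hm0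

theorem RightDvd.eq_iv {p q : P} {e : IntervalMonoid P} (hpq : p < q) (h : RightDvd e (iv p q))
    (he : e ≠ 1) : ∃ t, p ≤ t ∧ t < q ∧ e = iv t q := by
  rw [← leftDvd_flip_iff, flip_iv hpq.le] at h
  have he' : (flip e).unop ≠ 1 := fun h' => he (by rw [← unflip_flip e, h']; simp)
  obtain ⟨t, h1, h2, h3⟩ := LeftDvd.eq_iv (P := Pᵒᵈ) (p := OrderDual.toDual q)
    (q := OrderDual.toDual p) hpq h he'
  refine ⟨OrderDual.ofDual t, h2, h1, ?_⟩
  rw [← unflip_flip e, h3, unflip_iv h1.le]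
  rfl

theorem iv_injective {p q p' q' : P} (h : p < q) (h' : p' < q') (heq : iv p q = iv p' q') :
    p = p' ∧ q = q' := by
  have := (isNF_singleton h).inj (isNF_singleton h') (by simpa using heq)
  simpa using this

/-- The multifraction with the entries `a₁`, `a₂`, `a₃`, the first one being positive. -/
def Multifraction.ofThree {M : Type*} [Monoid M] (a₁ a₂ a₃ : M) : Multifraction M :=
  ⟨[(true, a₁), (false, a₂), (true, a₃)], by simp⟩

/-- The join hypothesis excludes a common right divisor at level one. The last hypothesis excludes
level two: no proper left divisor `[r, t]` of `[r, s]` other than `1`, nor `[r, s]` itself, has a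
common right multiple with `[r, q]`. -/
theorem irreducible_ofThree {p q r s : P} (hpq : p < q) (hrq : r < q) (hrs : r < s)
    (h1 : IsLUB {p, r} q) (h2 : ∀ t u, r < t → t ≤ s → t ≤ u → ¬ q ≤ u) :
    (Multifraction.ofThree (iv p q) (iv r q) (iv r s)).Irreducible := by
  rintro ⟨b, x, hx, h⟩
  generalize hL : (Multifraction.ofThree (iv p q) (iv r q) (iv r s)).entries = L at h
  simp only [Multifraction.ofThree] at hL
  generalize b.entries = L' at h
  cases h with
  | pos pre post a₁ a₂ a₃ b₁ b₂ b₃ x' _ _ _ _ =>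
    have hlen := congrArg List.length hL
    rcases pre with _ | ⟨_, pre⟩ <;> simp at hL hlen
    omega
  | neg pre post a₁ a₂ a₃ b₁ b₂ b₃ x' _ hx' _ h₃ =>
    have hlen := congrArg List.length hL
    obtain rfl : pre = [] := List.length_eq_zero_iff.1 (by simp at hlen; omega)
    simp at hL
    obtain ⟨rfl, rfl, rfl, -⟩ := hL
    obtain ⟨t, hrt, hts, rfl⟩ := LeftDvd.eq_iv hrs ⟨_, h₃⟩ hx
    obtain ⟨u, htu, hqu, -⟩ := LeftDvd.iv_lub (u := t) hrt hrq ⟨_, hx'⟩ ⟨_, rfl⟩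
    exact h2 t u hrt hts htu hqu
  | pos_one post a₁ a₂ b₁ b₂ h₁ h₂ =>
    simp at hL
    obtain ⟨rfl, rfl, -⟩ := hL
    obtain ⟨t, hpt, htq, rfl⟩ := RightDvd.eq_iv hpq ⟨_, h₁⟩ hx
    obtain ⟨t', hrt, htq', heq⟩ := RightDvd.eq_iv hrq ⟨_, h₂⟩ hx
    obtain ⟨rfl, -⟩ := iv_injective htq htq' heq
    exact absurd (h1.2 (by simp [hpt, hrt])) (not_le_of_gt htq)
  | neg_one post a₁ a₂ b₁ b₂ h₁ h₂ => simp at hL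

theorem red_ofThree {b p q r s : P} (hbp : b < p) (hbr : b < r) (hrs : r ≤ s)
    (h1 : IsLUB {p, r} q) :
    (Multifraction.ofThree 1 (iv b p) (iv b s)).Red
      (Multifraction.ofThree (iv p q) (iv r q) (iv r s)) := by
  have hpq : p ≤ q := h1.1 (by simp)
  have hrq : r ≤ q := h1.1 (by simp)
  refine ⟨iv b r, iv_ne_one hbr, ?_⟩
  refine .neg [] [] 1 (iv b p) (iv b s) (iv p q) (iv r q) (iv r s) (iv p q) (one_mul _).symm
    ?_ ?_ (iv_mul hbr.le hrs)
  · rw [iv_mul hbr.le hrq, iv_mul hbp.le hpq]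
  · rw [iv_mul hbp.le hpq]
    exact isRightLcm_iv hbr hbp (by rwa [Set.pair_comm])

/-- Reduction is not convergent if there are three elements above `b` any two of which, but not
all three of which, have an upper bound. -/
theorem not_convergent_of_three {b y₀ y₁ y₂ z₁ z₂ z₃ : P} (h0 : b < y₀) (h1 : b < y₁)
    (h2 : b < y₂) (h01 : IsLUB {y₀, y₁} z₁) (h02 : IsLUB {y₀, y₂} z₂) (h01' : y₀ < z₁)
    (h11' : y₁ < z₁) (h02' : y₀ < z₂) (h22' : y₂ < z₂) (h13 : y₁ < z₃) (h23 : y₂ < z₃)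
    (hz : z₁ ≠ z₂)
    (hz₁ : ∀ t u, y₁ < t → t ≤ z₃ → t ≤ u → ¬ z₁ ≤ u)
    (hz₂ : ∀ t u, y₂ < t → t ≤ z₃ → t ≤ u → ¬ z₂ ≤ u) :
    ¬ Convergent (IntervalMonoid P) := by
  intro h
  obtain ⟨c, -, hc⟩ := h (Multifraction.ofThree 1 (iv b y₀) (iv b z₃))
  have e1 := hc _ ⟨.single (red_ofThree h0 h1 h13.le h01),
    irreducible_ofThree h01' h11' h13 h01 hz₁⟩
  have e2 := hc _ ⟨.single (red_ofThree h0 h2 h23.le h02),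
    irreducible_ofThree h02' h22' h23 h02 hz₂⟩
  have e := congrArg Multifraction.entries (e1.trans e2.symm)
  simp only [Multifraction.ofThree, List.cons.injEq, Prod.mk.injEq, true_and] at e
  exact hz (iv_injective h01' h02' e.1).2

end NonConvergence

namespace PA

variable {n : ℕ}

theorem le_iff (a b : PA n) : a ≤ b ↔ a = b ∨ StripLt (lv a) (pos a) (lv b) (pos b) := by
  rw [le_iff_eq_or_lt, lt_iff]

theorem eq_of_top_le {a b : PA n} (ha : lv a = 2) (h : a ≤ b) : a = b := by
  rcases (le_iff a b).1 h with h | h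
  · exact h
  · unfold StripLt at h
    omega

/-- Two middle vertices with a single top vertex above them. -/
theorem isLUB_of_middle {a b d : PA n} (ha : lv a = 1) (hb : lv b = 1) (hd : lv d = 2)
    (hne : pos a ≠ pos b) (had : a < d) (hbd : b < d)
    (h : ∀ c, StripVertex 0 (n + 1) 2 c → StripLt 1 (pos a) 2 c → StripLt 1 (pos b) 2 c →
      c = pos d) : IsLUB {a, b} d := by
  refine ⟨by simp [had.le, hbd.le], fun e he => ?_⟩
  have hae : a ≤ e := he (by simp)
  have hbe : b ≤ e := he (by simp)
  rw [le_iff] at hae hbe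
  have hab : a ≠ b := fun h => hne (congrArg pos h)
  rcases hae with rfl | hae
  · rcases hbe with rfl | hbe
    · exact absurd rfl hab
    · unfold StripLt at hbe
      omega
  · have he : lv e = 2 := by
      rcases hae with h | h | h <;> omega
    rcases hbe with rfl | hbe
    · omega
    · rw [ha, he] at hae
      rw [hb, he] at hbe
      rw [ext_of_pos e d (he.trans hd.symm) (h _ (he ▸ stripVertex e) hae hbe)]

theorem not_convergent (hn : 1 ≤ n) : ¬ Convergent (IntervalMonoid (PA n)) := by
  obtain ⟨b, hb, hb'⟩ := exists_vertex (n := n) 0 1 (stripVertex_zero.2 (by omega))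
  obtain ⟨y₀, hy₀, hy₀'⟩ := exists_vertex (n := n) 1 0 (stripVertex_one.2 (by omega))
  obtain ⟨y₁, hy₁, hy₁'⟩ := exists_vertex (n := n) 1 1 (stripVertex_one.2 (by omega))
  obtain ⟨y₂, hy₂, hy₂'⟩ := exists_vertex (n := n) 1 2 (stripVertex_one.2 (by omega))
  obtain ⟨z₁, hz₁, hz₁'⟩ := exists_vertex (n := n) 2 0 (stripVertex_two.2 (by omega))
  obtain ⟨z₂, hz₂, hz₂'⟩ := exists_vertex (n := n) 2 1 (stripVertex_two.2 (by omega))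
  obtain ⟨z₃, hz₃, hz₃'⟩ := exists_vertex (n := n) 2 2 (stripVertex_two.2 (by omega))
  have h01' : y₀ < z₁ := by
    rw [lt_iff, hy₀, hz₁, hy₀', hz₁']; exact stripLt_one_two.2 (by omega)
  have h11' : y₁ < z₁ := by
    rw [lt_iff, hy₁, hz₁, hy₁', hz₁']; exact stripLt_one_two.2 (by omega)
  have h02' : y₀ < z₂ := by
    rw [lt_iff, hy₀, hz₂, hy₀', hz₂']; exact stripLt_one_two.2 (by omega)
  have h22' : y₂ < z₂ := by
    rw [lt_iff, hy₂, hz₂, hy₂', hz₂']; exact stripLt_one_two.2 (by omega)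
  have h13 : y₁ < z₃ := by
    rw [lt_iff, hy₁, hz₃, hy₁', hz₃']; exact stripLt_one_two.2 (by omega)
  have h23 : y₂ < z₃ := by
    rw [lt_iff, hy₂, hz₃, hy₂', hz₃']; exact stripLt_one_two.2 (by omega)
  have hbot : ∀ y : PA n, lv y = 1 → 0 ≤ pos y → pos y ≤ 2 → b < y := by
    intro y hy h h'
    rw [lt_iff, hb, hy, hb']
    exact stripLt_zero_one.2 (by omega)
  have key : ∀ y z : PA n, lv y = 1 → lv z = 2 → pos z ≠ 2 → ∀ t u, y < t → t ≤ z₃ → t ≤ u →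
      ¬ z ≤ u := by
    intro y z hy hz hne t u hyt _ htu hzu
    -- Whatever is above a middle vertex is at the top, hence maximal. So `t` is both `z₃` and `u`,
    -- and then `z` would be `z₃` too.
    have ht : lv t = 2 := by
      rw [lt_iff] at hyt
      rcases hyt with h | h | h <;> omega
    obtain rfl := eq_of_top_le ht htu
    obtain rfl := eq_of_top_le hz hzu
    obtain rfl := eq_of_top_le ht ‹z ≤ z₃›
    exact hne hz₃'
  refine not_convergent_of_three (hbot y₀ hy₀ (by omega) (by omega))
    (hbot y₁ hy₁ (by omega) (by omega)) (hbot y₂ hy₂ (by omega) (by omega))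
    (isLUB_of_middle hy₀ hy₁ hz₁ (by omega) h01' h11' fun c h1 h2 h3 => ?_)
    (isLUB_of_middle hy₀ hy₂ hz₂ (by omega) h02' h22' fun c h1 h2 h3 => ?_)
    h01' h11' h02' h22' h13 h23 (fun h => by rw [h, hz₂'] at hz₁'; omega)
    (key y₁ z₁ hy₁ hz₁ (by omega)) (key y₂ z₂ hy₂ hz₂ (by omega))
  · rw [stripVertex_two] at h1
    rw [stripLt_one_two] at h2 h3
    omega
  · rw [stripVertex_two] at h1
    rw [stripLt_one_two] at h2 h3
    omega

end PA

end MFR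

theorem proposition5p9 :
    ∀ n : ℕ, 1 ≤ n →
      Nat.card (MFR.PA n) = 3 * n + 4 ∧
      MFR.IsGcdMonoid (MFR.IntervalMonoid (MFR.PA n)) ∧
      MFR.IsNoetherianMonoid (MFR.IntervalMonoid (MFR.PA n)) ∧
      MFR.SemiConvergent (MFR.IntervalMonoid (MFR.PA n)) ∧
      ¬ MFR.Convergent (MFR.IntervalMonoid (MFR.PA n)) ∧
      (2 ≤ n → ∃ x : Fin ((2 * n + 2) + 1) → MFR.PA n, MFR.IsSimpleClosedZigzag x) := by
  intro n hn
  have S := MFR.PA.strip n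
  have hinf := MFR.condInf_of_strip S
  have hsup := MFR.condSup_of_strip S
  have hh := MFR.strictMono_of_strip S
  obtain ⟨len, hlen⟩ := MFR.exists_isLength hh
  exact ⟨MFR.PA.nat_card n, MFR.isGcdMonoid_intervalMonoid hinf hsup, hlen.isNoetherianMonoid,
    MFR.semiConvergent_intervalMonoid hinf hsup (MFR.closedZigzagsReducible_of_strip S) hh,
    MFR.PA.not_convergent hn, MFR.PA.exists_isSimpleClosedZigzag⟩
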